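/- **Setting.** Let $m,n\ge 1$ and let $\mathcal A=(a_{ij})\in\mathbb R^{n\times n}$ be a symmetric stochastic matrix with nonnegative entries and $a_{ii}>0$ for all $i$; it defines an undirected graph $\mathscr G$ on $\{1,\dots,n\}$ in which $i,j$ are adjacent iff $a_{ij}>0$, with neighbour sets $N^i=\{j: a_{ij}>0\}\ni i$. Let $L=I-\mathcal A$ and let $Q\ge D(\mathscr G)$ be an integer, where $D(\mathscr G)$ is the diameter. On a probability space let $\varphi^i_k\in\mathbb R^m$ ($k\ge0$) and $\varepsilon^i_k\in\mathbb R$ ($k\ge1$) be random, $1\le i\le n$, let $\theta\in\mathbb R^m$, and let $y^i_{k+1}=\theta^T\varphi^i_k+\varepsilon^i_{k+1}$. Put $r^i_k=1+\sum_{j=1}^k\|\varphi^i_j\|^2$, $R_k=\mathrm{diag}(r^1_k,\dots,r^n_k)$ (with $\|\cdot\|$ the spectral norm), $\Xi_k=(\varepsilon_k^1,\dots,\varepsilon_k^n)$ and $\mathscr F_k=\sigma\{\varphi^i_j,\varepsilon^i_j: 1\le i\le n,\ j\le k\}$. With step sizes $\mu,\nu\in(0,1)$ and arbitrary initial estimates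 $\hat\theta^i_0$, the distributed stochastic gradient algorithm is $$x^i_k(0)=\frac{\|\varphi^i_k\|^2}{r^i_k},\qquad x^i_k(q+1)=\sum_{j\in N^i}a_{ij}x^j_k(q),\qquad z^i_k=x^i_k(Q)\sum_{l\in N^i}a_{li}(\hat\theta^i_k-\hat\theta^l_k),$$ $$\hat\theta^i_{k+1}=\hat\theta^i_k+\mu\frac{\varphi^i_k}{r^i_k}\bigl(y^i_{k+1}-(\varphi^i_k)^T\hat\theta^i_k\bigr)-\mu\nu\sum_{j\in N^i}a_{ij}(z^i_k-z^j_k),$$ and $\widetilde\Theta_k=\mathrm{col}(\theta-\hat\theta^1_k,\dots,\theta-\hat\theta^n_k)\in\mathbb R^{mn}$. **Hypotheses.** 1. $\mu(1+4\nu)<1$, and $\mathscr G$ is connected. 2. There is an index $i_1$ with $\limsup_{k\to\infty} r^{i_1}_k/r^{i_1}_{k-1}=r^*<\infty$ a.s., and there is $\gamma$ with $\max_i r^i_k/\min_i r^i_k\le\gamma$ for all $k$ a.s. ($r^*$ and $\gamma$ may depend on the sample $\omega$). 3. (Cooperative excitation) $\|R_k\|\to\infty$ a.s., and there are constants $N>0$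 and $K_0$ such that for all $k\ge K_0$, $\lambda^{(k)}_{\max}/\lambda^{(k)}_{\min}\le N(\log\|R_k\|)^{1/3}$ a.s., where $\lambda^{(k)}_{\max},\lambda^{(k)}_{\min}$ are the extreme eigenvalues of $\frac nm I_m+\sum_{i=1}^n\sum_{j=1}^k\varphi^i_j(\varphi^i_j)^T$. 4. (Noise) Each $\varepsilon^i_k$ is integrable, $E(\Xi_{k+1}\mid\mathscr F_k)=0$, and there are $c_0>0$ and $\varepsilon\in[0,1)$ (which may depend on $\omega$) with $E(\|\Xi_{k+1}\|^2\mid\mathscr F_k)\le c_0\|R_k\|^{\varepsilon}$ a.s. for all $k\ge0$. **Conclusion.** Let $\delta\in(0,\frac{1-\varepsilon}2)$ be arbitrary ($\delta$ may depend on $\omega$). Let $a=\min_{i,j}(\mathcal A^Q)_{ij}$, and let $l$ be the algebraic connectivity, i.e. the second smallest eigenvalue of $L$ (equivalently the $(m+1)$-th smallest eigenvalue of $L\otimes I_m$). Set $$\sigma=\frac{l^2a\nu}{2n+l^2a\nu n}\ (n\ge2),\quad \sigma=1\ (n=1),\qquad \alpha=2Nm(n+2)+1,$$ $$c^*=\frac{\mu\sigma}{1+[n\gamma(\alpha+1)]^2\cdot\frac{2n\gamma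 r^*\alpha}{3}},\qquad \delta_1=\frac{\delta\,c^*}{6m^3n^4(1+\delta)}.$$ Then almost surely $\delta_1>0$ and $$\|\widetilde\Theta_k\|=O\bigl((\log\|R_k\|)^{-\delta_1}\bigr),$$ i.e. there is a finite $C>0$ (depending on $\omega$) such that $\|\widetilde\Theta_k\|\le C(\log\|R_k\|)^{-\delta_1}$ for every $k$ with $\|R_k\|>1$. -/

import Mathlib

open MeasureTheory Filter
open scoped Matrix.Norms.L2Operator RealInnerProductSpace

/-- An undirected weighted sensor graph on `n` nodes, given by its symmetric stochastic weight
matrix. Two nodes are joined by an edge exactly when their weight is positive, and every sensor is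
its own neighbour. -/
structure SensorGraph (n : ℕ) where
  weight : Matrix (Fin n) (Fin n) ℝ
  symm : weight.IsSymm
  nonneg : ∀ i j, 0 ≤ weight i j
  stochastic : ∀ i, ∑ j, weight i j = 1
  self_pos : ∀ i, 0 < weight i i

namespace SensorGraph

variable {n : ℕ} (W : SensorGraph n)

/-- The underlying simple graph (self-loops are irrelevant for paths and distances). -/
def graph : SimpleGraph (Fin n) where
  Adj i j := i ≠ j ∧ 0 < W.weight i j
  symm := ⟨fun i j h => ⟨h.1.symm, by rw [W.symm.apply i j]; exact h.2⟩⟩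
  loopless := ⟨fun _ h => h.1 rfl⟩

/-- The neighbour set of sensor `i`; it contains `i`. -/
noncomputable def neighbors (i : Fin n) : Finset (Fin n) :=
  Finset.univ.filter fun j => 0 < W.weight i j

/-- The Laplacian matrix `L = I - 𝒜`. -/
def laplacian : Matrix (Fin n) (Fin n) ℝ := 1 - W.weight

theorem laplacian_isHermitian : W.laplacian.IsHermitian := by
  have h : W.weight.IsHermitian := by
    rw [Matrix.IsHermitian, Matrix.conjTranspose_eq_transpose_of_trivial]
    exact W.symm
  exact Matrix.isHermitian_one.sub h

/-- The second smallest eigenvalue (with multiplicity) of the Laplacian. It is also the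
`(m + 1)`-th eigenvalue of `L ⊗ I_m` in nondecreasing order. (`eigenvalues₀` lists the `n`
eigenvalues in nonincreasing order.) -/
noncomputable def algebraicConnectivity (hn : 2 ≤ n) : ℝ :=
  W.laplacian_isHermitian.eigenvalues₀ ⟨n - 2, by rw [Fintype.card_fin]; omega⟩

/-- The smallest entry of the `Q`-th power of the weight matrix. -/
noncomputable def minPowerEntry (Q : ℕ) : ℝ := ⨅ i, ⨅ j, (W.weight ^ Q) i j

/-- The constant `σ = l² a ν / (2 n + l² a ν n)`, where `l` is the algebraic connectivity and `a`
the smallest entry of `𝒜 ^ Q`. For a single sensor there is no second eigenvalue and no coupling,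
and the constant is `1` (the limit of the formula as `l → ∞`). -/
noncomputable def couplingConstant (Q : ℕ) (ν : ℝ) : ℝ :=
  if hn : 2 ≤ n then
    W.algebraicConnectivity hn ^ 2 * W.minPowerEntry Q * ν /
      (2 * n + W.algebraicConnectivity hn ^ 2 * W.minPowerEntry Q * ν * n)
  else 1

end SensorGraph

namespace DistributedSG

variable {m n : ℕ}

/-- `r^i_k = 1 + ∑_{j=1}^k ‖φ^i_j‖²`, for a path `φ` of regressors (`φ k i` stands for `φ^i_k`). -/
noncomputable def r (φ : ℕ → Fin n → EuclideanSpace ℝ (Fin m)) (k : ℕ) (i : Fin n) : ℝ :=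
  1 + ∑ j ∈ Finset.Icc 1 k, ‖φ j i‖ ^ 2

/-- `R_k = diag(r^1_k, …, r^n_k)`. Its norm `‖R_k‖` is the spectral norm. -/
noncomputable def R (φ : ℕ → Fin n → EuclideanSpace ℝ (Fin m)) (k : ℕ) :
    Matrix (Fin n) (Fin n) ℝ :=
  Matrix.diagonal (r φ k)

/-- The diffusion process `x^i_k(q)`. -/
noncomputable def diffusion (W : SensorGraph n) (φ : ℕ → Fin n → EuclideanSpace ℝ (Fin m))
    (k : ℕ) : ℕ → Fin n → ℝ
  | 0, i => ‖φ k i‖ ^ 2 / r φ k i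
  | q + 1, i => ∑ j ∈ W.neighbors i, W.weight i j * diffusion W φ k q j

/-- `z^i_k = x^i_k(Q) ∑_{l ∈ N^i} a_{li} (θ̂^i_k - θ̂^l_k)`, for the current estimates `est`. -/
noncomputable def disagreement (W : SensorGraph n) (Q : ℕ)
    (φ : ℕ → Fin n → EuclideanSpace ℝ (Fin m)) (k : ℕ)
    (est : Fin n → EuclideanSpace ℝ (Fin m)) (i : Fin n) : EuclideanSpace ℝ (Fin m) :=
  diffusion W φ k Q i • ∑ l ∈ W.neighbors i, W.weight l i • (est i - est l)

/-- The observation `y^i_{k+1} = θᵀ φ^i_k + ε^i_{k+1}`. -/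
noncomputable def observation (θ : EuclideanSpace ℝ (Fin m))
    (φ : ℕ → Fin n → EuclideanSpace ℝ (Fin m)) (noise : ℕ → Fin n → ℝ)
    (k : ℕ) (i : Fin n) : ℝ :=
  ⟪θ, φ k i⟫ + noise (k + 1) i

/-- The estimates `θ̂^i_k` produced by the distributed stochastic gradient algorithm. -/
noncomputable def estimate (W : SensorGraph n) (Q : ℕ) (μ ν : ℝ) (θ : EuclideanSpace ℝ (Fin m))
    (φ : ℕ → Fin n → EuclideanSpace ℝ (Fin m)) (noise : ℕ → Fin n → ℝ)
    (init : Fin n → EuclideanSpace ℝ (Fin m)) : ℕ → Fin n → EuclideanSpace ℝ (Fin m)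
  | 0 => init
  | k + 1 => fun i =>
      let est := estimate W Q μ ν θ φ noise init k
      est i
        + (μ * (observation θ φ noise k i - ⟪φ k i, est i⟫) / r φ k i) • φ k i
        - (μ * ν) • ∑ j ∈ W.neighbors i,
            W.weight i j • (disagreement W Q φ k est i - disagreement W Q φ k est j)

/-- The stacked estimation error `Θ̃_k = col(θ - θ̂^1_k, …, θ - θ̂^n_k)`. -/
noncomputable def errorVec (W : SensorGraph n) (Q : ℕ) (μ ν : ℝ) (θ : EuclideanSpace ℝ (Fin m))
    (φ : ℕ → Fin n → EuclideanSpace ℝ (Fin m)) (noise : ℕ → Fin n → ℝ)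
    (init : Fin n → EuclideanSpace ℝ (Fin m)) (k : ℕ) : EuclideanSpace ℝ (Fin n × Fin m) :=
  WithLp.toLp 2 fun p => θ p.2 - estimate W Q μ ν θ φ noise init k p.1 p.2

/-- The matrix `(n/m) I_m + ∑_{i=1}^n ∑_{j=1}^k φ^i_j (φ^i_j)ᵀ`. -/
noncomputable def excitation (φ : ℕ → Fin n → EuclideanSpace ℝ (Fin m)) (k : ℕ) :
    Matrix (Fin m) (Fin m) ℝ :=
  ((n : ℝ) / m) • (1 : Matrix (Fin m) (Fin m) ℝ) +
    ∑ i, ∑ j ∈ Finset.Icc 1 k, Matrix.vecMulVec (φ j i).ofLp (φ j i).ofLp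

/-- The largest eigenvalue of a symmetric matrix. -/
noncomputable def lambdaMax (A : Matrix (Fin m) (Fin m) ℝ) : ℝ := sSup (spectrum ℝ A)

/-- The smallest eigenvalue of a symmetric matrix. -/
noncomputable def lambdaMin (A : Matrix (Fin m) (Fin m) ℝ) : ℝ := sInf (spectrum ℝ A)

/-- `𝓕_k = σ(φ^i_j (0 ≤ j ≤ k), ε^i_j (1 ≤ j ≤ k), i = 1, …, n)`. -/
@[reducible] def history {Ω : Type*} (φ : ℕ → Fin n → Ω → EuclideanSpace ℝ (Fin m))
    (noise : ℕ → Fin n → Ω → ℝ) (k : ℕ) : MeasurableSpace Ω :=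
  (⨆ j ∈ Set.Iic k, ⨆ i, MeasurableSpace.comap (φ j i) inferInstance) ⊔
    (⨆ j ∈ Set.Icc 1 k, ⨆ i, MeasurableSpace.comap (noise j i) inferInstance)

/-- The constant `α = 2 N m (n + 2) + 1`. -/
noncomputable def alpha (m n : ℕ) (N : ℝ) : ℝ := 2 * N * m * (n + 2) + 1

/-- The constant `c* = μ σ / (1 + (n γ (α + 1))² · (2 n γ r* α / 3))`. -/
noncomputable def cStar (W : SensorGraph n) (m Q : ℕ) (μ ν N γ rStar : ℝ) : ℝ :=
  μ * W.couplingConstant Q ν /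
    (1 + (n * γ * (alpha m n N + 1)) ^ 2 * (2 * n * γ * rStar * alpha m n N / 3))

/-- The rate exponent `δ₁ = δ c* / (6 m³ n⁴ (1 + δ))`. -/
noncomputable def rateExponent (W : SensorGraph n) (m Q : ℕ) (μ ν N γ rStar δ : ℝ) : ℝ :=
  δ * cStar W m Q μ ν N γ rStar / (6 * m ^ 3 * n ^ 4 * (1 + δ))

end DistributedSG

/-! The stacked error obeys `Θ (k+1) = Θ k - A k (Θ k) - w k`, where `A k` is the positive
semidefinite operator `μ (Φ R⁻¹ Φᵀ + ν L X L)` and `w k` is the noise input. Time is measured by the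
total energy `s k = ∑ᵢ rⁱ_k`, the trace of the excitation matrix, through `l k = 1 + log (s k)`.

Deterministic part. The step-size condition gives `‖A v‖² ≤ t ⟪v, A v⟫` both with `t = 1` and with
`t` of order `1 - s k / s (k+1)`; the latter caps add up, over a block `[a, b)`, to at most a
multiple of `l b - l a`. The excitation condition says that on such a block `∑ ⟪v, A j v⟫` is at
least a constant times `l b ^ (-1/3) - s a / s b`, times `‖v‖²`. Take blocks along which `l` grows
by about `x = l ^ (1/6)`. Then `s a / s b ≤ exp (-x)` is negligible, the excitation is of order
`x⁻²`, and `norm_sq_le_of_block` loses a factor `1 + T²` of order `x²`. So `‖v‖²` contracts by `1 -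
c₁ / x⁴`, whereas `l ^ (2K)` grows by a factor of only `1 + O(x⁻⁵)`. The noise-free error therefore
decays faster than every power of `log s`.

Noise. For a small `η > 0` (with `2η < 1 - ε`) the sums `G k = ∑ s_j ^ η w_j` converge almost
surely: their conditional variances are dominated by increments of a negative power of `s` and
telescope. Summation by parts replaces `Θ` by `Θ + s ^ (-η) G`, whose one-step defect is at most a
multiple of `s k ^ (-η) - s (k+1) ^ (-η)`. This stays summable against any power of `log s`, so the
perturbed recursion decays equally fast.

Decay beyond every power of the logarithm contains the stated rate as soon as its exponent is
positive; what remains for `δ₁` is positivity, which rests on a nonzero algebraic connectivity and a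
positive matrix `𝒜 ^ Q`. -/

/-! ### Contraction of products of gradient steps, deterministic and perturbed. -/

section Contraction

variable {H : Type*} [NormedAddCommGroup H] [InnerProductSpace ℝ H]

/-- A gradient step `v ↦ v - w` with `‖w‖² ≤ ⟪v, w⟫` decreases the squared norm by `⟪v, w⟫`. -/
theorem norm_sub_sq_le_of_norm_sq_le_inner {v w : H} (h : ‖w‖ ^ 2 ≤ ⟪v, w⟫) :
    ‖v - w‖ ^ 2 ≤ ‖v‖ ^ 2 - ⟪v, w⟫ := by
  rw [norm_sub_sq_real]; linarith

/-- Cauchy–Schwarz gives `⟪v, w⟫² ≤ t ‖v‖² ⟪v, w⟫`, and one factor cancels. With `w = A v` it bounds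
the quadratic form of `A` without assuming symmetry. -/
theorem inner_le_mul_norm_sq_of_norm_sq_le {v w : H} {t : ℝ} (ht : 0 ≤ t) (h0 : 0 ≤ ⟪v, w⟫)
    (h : ‖w‖ ^ 2 ≤ t * ⟪v, w⟫) : ⟪v, w⟫ ≤ t * ‖v‖ ^ 2 := by
  rcases h0.eq_or_lt with h2 | h2
  · rw [← h2]; positivity
  · have h3 : ⟪v, w⟫ ^ 2 ≤ ‖v‖ ^ 2 * (t * ⟪v, w⟫) := by
      calc ⟪v, w⟫ ^ 2 ≤ (‖v‖ * ‖w‖) ^ 2 := by gcongr; exact real_inner_le_norm v w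
        _ = ‖v‖ ^ 2 * ‖w‖ ^ 2 := by ring
        _ ≤ _ := by gcongr
    nlinarith

/-- The parallelogram law for the form `⟪v, A v⟫`: cross terms at `v + w` and `v - w` cancel, so no
symmetry is needed. -/
theorem inner_map_add_le (A : H →ₗ[ℝ] H) (hA : ∀ v, 0 ≤ ⟪v, A v⟫) (v w : H) :
    ⟪v + w, A (v + w)⟫ ≤ 2 * ⟪v, A v⟫ + 2 * ⟪w, A w⟫ := by
  have h := hA (v - w)
  simp only [map_sub, map_add, inner_sub_left, inner_sub_right, inner_add_left,
    inner_add_right] at h ⊢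
  linarith

/-- Contraction of a product of gradient steps over a block of times. -/
theorem norm_sq_le_of_block {A : ℕ → H →ₗ[ℝ] H} {τ : ℕ → ℝ} (hτ : ∀ j, 0 ≤ τ j)
    (hA : ∀ j v, ‖A j v‖ ^ 2 ≤ ⟪v, A j v⟫)
    (hAτ : ∀ j v, ‖A j v‖ ^ 2 ≤ τ j * ⟪v, A j v⟫)
    {v : ℕ → H} {a b : ℕ} (hab : a ≤ b) (hv : ∀ j, a ≤ j → v (j + 1) = v j - A j (v j))
    {T lam : ℝ} (hT : ∑ j ∈ Finset.Ico a b, τ j ≤ T)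
    (hlam : lam * ‖v a‖ ^ 2 ≤ ∑ j ∈ Finset.Ico a b, ⟪v a, A j (v a)⟫) :
    ‖v b‖ ^ 2 ≤ (1 - lam / (2 * (1 + T ^ 2))) * ‖v a‖ ^ 2 := by
  have hA0 : ∀ j v, 0 ≤ ⟪v, A j v⟫ := fun j v => (sq_nonneg _).trans (hA j v)
  have hT0 : 0 ≤ T := (Finset.sum_nonneg fun j _ => hτ j).trans hT
  set q : ℕ → ℝ := fun j => ⟪v j, A j (v j)⟫ with hq
  -- The energy lost up to time `c` dominates the dissipation `∑ q j`.
  have hdec : ∀ c, a ≤ c → ∑ j ∈ Finset.Ico a c, q j ≤ ‖v a‖ ^ 2 - ‖v c‖ ^ 2 := by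
    intro c hc
    induction c, hc using Nat.le_induction with
    | base => simp
    | succ c hc ih =>
      rw [Finset.sum_Ico_succ_top hc, hv c hc]
      have := norm_sub_sq_le_of_norm_sq_le_inner (hA c (v c))
      simp only [hq] at ih ⊢
      linarith
  have hdiff : ∀ c, a ≤ c → v a - v c = ∑ j ∈ Finset.Ico a c, A j (v j) := by
    intro c hc
    induction c, hc using Nat.le_induction with
    | base => simp
    | succ c hc ih =>
      rw [Finset.sum_Ico_succ_top hc, hv c hc, ← ih]; abel
  set D := ‖v a‖ ^ 2 - ‖v b‖ ^ 2 with hD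
  -- The trajectory moves little within the block: by Cauchy–Schwarz its displacement is controlled
  -- by the total cap `T` times the energy drop `D`.
  have hsub : ∀ c, a ≤ c → c ≤ b → ‖v a - v c‖ ^ 2 ≤ T * D := by
    intro c hac hcb
    have hss : Finset.Ico a c ⊆ Finset.Ico a b := Finset.Ico_subset_Ico le_rfl hcb
    have h1 : ‖v a - v c‖ ≤ ∑ j ∈ Finset.Ico a c, ‖A j (v j)‖ := by
      rw [hdiff c hac]
      exact norm_sum_le _ _
    calc ‖v a - v c‖ ^ 2 ≤ (∑ j ∈ Finset.Ico a c, ‖A j (v j)‖) ^ 2 := by gcongr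
      _ ≤ (∑ j ∈ Finset.Ico a c, τ j) * ∑ j ∈ Finset.Ico a c, q j :=
        Finset.sum_sq_le_sum_mul_sum_of_sq_le_mul _ (fun j _ => hτ j)
          (fun j _ => hA0 _ _) fun j _ => hAτ j (v j)
      _ ≤ T * D := by
        refine mul_le_mul ?_ ?_ (Finset.sum_nonneg fun j _ => hA0 _ _) hT0
        · exact (Finset.sum_le_sum_of_subset_of_nonneg hss fun j _ _ => hτ j).trans hT
        · exact (Finset.sum_le_sum_of_subset_of_nonneg hss fun j _ _ => hA0 _ _).trans
            (hdec b hab)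
  -- The excitation is known for the frozen vector `v a`, the dissipation along the moving `v j`.
  -- Exchanging one for the other costs `τ j * (T * D)` per step; summed over the block this is the
  -- origin of `T²`.
  have hkey : lam * ‖v a‖ ^ 2 ≤ 2 * D + 2 * (T * (T * D)) := by
    have hD0 : 0 ≤ D := (Finset.sum_nonneg fun j _ => hA0 _ _).trans (hdec b hab)
    calc lam * ‖v a‖ ^ 2 ≤ ∑ j ∈ Finset.Ico a b, ⟪v a, A j (v a)⟫ := hlam
      _ ≤ ∑ j ∈ Finset.Ico a b, (2 * q j + 2 * (τ j * (T * D))) := by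
        refine Finset.sum_le_sum fun j hj => ?_
        obtain ⟨h1, h2⟩ := Finset.mem_Ico.1 hj
        have h3 := inner_map_add_le (A j) (hA0 j) (v j) (v a - v j)
        rw [add_sub_cancel] at h3
        have h4 := inner_le_mul_norm_sq_of_norm_sq_le (hτ j) (hA0 j (v a - v j)) (hAτ j (v a - v j))
        have h5 := mul_le_mul_of_nonneg_left (hsub j h1 h2.le) (hτ j)
        simp only [hq]
        linarith
      _ = 2 * ∑ j ∈ Finset.Ico a b, q j + 2 * ((∑ j ∈ Finset.Ico a b, τ j) * (T * D)) := by
        rw [Finset.sum_add_distrib, ← Finset.mul_sum, ← Finset.mul_sum, ← Finset.sum_mul]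
      _ ≤ _ := by
        have := hdec b hab
        gcongr
  have hpos : 0 < 2 * (1 + T ^ 2) := by positivity
  have : lam / (2 * (1 + T ^ 2)) * ‖v a‖ ^ 2 ≤ D := by
    rw [div_mul_eq_mul_div, div_le_iff₀ hpos]
    linarith
  rw [sub_mul, one_mul]
  linarith

/-- The numerical heart of the block argument. -/
theorem exists_block_factor_le (K : ℕ) {c C κ : ℝ} (hc : 0 < c) (hC : 0 < C) :
    ∃ x₀ : ℝ, 1 ≤ x₀ ∧ ∀ x l l' : ℝ, x₀ ≤ x → l = x ^ 6 → l + x ≤ l' → l' ≤ l + 2 * x →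
      1 - c * (1 / (C * l' ^ (1 / 3 : ℝ)) - Real.exp (l - l')) /
        (2 * (1 + (κ * (l' - l)) ^ 2)) ≤ (l / l') ^ (2 * K) := by
  -- The excitation `c / (4 C x²)` divided by the denominator bound `2 (1 + 4κ²) x²` is exactly `c₁
  -- / x⁴`.
  set c₁ := c / (8 * C * (1 + 4 * κ ^ 2)) with hc₁
  have hc₁0 : 0 < c₁ := by positivity
  -- `x ≥ 24 C` makes the exponential at most half of the excitation term (through `x³/6 ≤ exp x`),
  -- and `x ≥ 4K / c₁` makes the gain `c₁ / x⁴` beat the Bernoulli loss `4K / x⁵`.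
  refine ⟨max 2 (max (24 * C) (4 * K / c₁)), le_trans (by norm_num) (le_max_left _ _), ?_⟩
  intro x l l' hx hl h1 h2
  have hx2 : 2 ≤ x := (le_max_left _ _).trans hx
  have hxC : 24 * C ≤ x := ((le_max_left _ _).trans (le_max_right _ _)).trans hx
  have hxK : 4 * K / c₁ ≤ x := ((le_max_right _ _).trans (le_max_right _ _)).trans hx
  have hx0 : 0 < x := by linarith
  have hl0 : 0 < l := by rw [hl]; positivity
  have hl'0 : 0 < l' := by linarith
  have hroot : l' ^ (1 / 3 : ℝ) ≤ 2 * x ^ 2 := by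
    have h3 : l' ≤ (2 * x ^ 2) ^ 3 := by
      have : x ≤ x ^ 6 := le_self_pow₀ (by linarith) (by norm_num)
      calc l' ≤ l + 2 * x := h2
        _ ≤ 8 * x ^ 6 := by rw [hl]; linarith
        _ = _ := by ring
    calc l' ^ (1 / 3 : ℝ) ≤ ((2 * x ^ 2) ^ 3) ^ (1 / 3 : ℝ) :=
          Real.rpow_le_rpow hl'0.le h3 (by norm_num)
      _ = 2 * x ^ 2 := by
        rw [← Real.rpow_natCast, ← Real.rpow_mul (by positivity)]
        norm_num
  have hexp : Real.exp (l - l') ≤ 1 / (4 * C * x ^ 2) := by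
    have h4 : Real.exp (l - l') ≤ Real.exp (-x) := Real.exp_le_exp.2 (by linarith)
    have h5 : x ^ 3 / 6 ≤ Real.exp x := by
      have := Real.pow_div_factorial_le_exp x hx0.le 3
      simpa [Nat.factorial] using this
    refine h4.trans ?_
    rw [Real.exp_neg, ← one_div]
    refine one_div_le_one_div_of_le (by positivity) (le_trans ?_ h5)
    have : 24 * C * x ^ 2 ≤ x * x ^ 2 := by gcongr
    nlinarith
  have hlam : c / (4 * C * x ^ 2) ≤ c * (1 / (C * l' ^ (1 / 3 : ℝ)) - Real.exp (l - l')) := by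
    have h6 : 1 / (2 * C * x ^ 2) ≤ 1 / (C * l' ^ (1 / 3 : ℝ)) := by
      refine one_div_le_one_div_of_le (by positivity) ?_
      calc C * l' ^ (1 / 3 : ℝ) ≤ C * (2 * x ^ 2) := by gcongr
        _ = _ := by ring
    have h7 : c / (4 * C * x ^ 2) = c * (1 / (2 * C * x ^ 2) - 1 / (4 * C * x ^ 2)) := by
      field_simp; ring
    rw [h7]
    gcongr
  have hden : 2 * (1 + (κ * (l' - l)) ^ 2) ≤ 2 * (1 + 4 * κ ^ 2) * x ^ 2 := by
    have h8 : (l' - l) ^ 2 ≤ (2 * x) ^ 2 := by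
      apply pow_le_pow_left₀ <;> linarith
    have h9 : (1 : ℝ) ≤ x ^ 2 := one_le_pow₀ (by linarith)
    have h10 : κ ^ 2 * (l' - l) ^ 2 ≤ κ ^ 2 * (2 * x) ^ 2 := by gcongr
    nlinarith
  have hdec : c₁ / x ^ 4 ≤ c * (1 / (C * l' ^ (1 / 3 : ℝ)) - Real.exp (l - l')) /
        (2 * (1 + (κ * (l' - l)) ^ 2)) := by
    calc c₁ / x ^ 4 = (c / (4 * C * x ^ 2)) / (2 * (1 + 4 * κ ^ 2) * x ^ 2) := by
          rw [hc₁]; field_simp; ring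
      _ ≤ _ := by
        apply div_le_div₀ _ hlam (by positivity) hden
        exact le_trans (by positivity) hlam
  have hbern : 1 - 4 * K / x ^ 5 ≤ (l / l') ^ (2 * K) := by
    have h11 : -(2 / x ^ 5) ≤ l / l' - 1 := by
      have h12 : l / l' - 1 = -((l' - l) / l') := by field_simp; ring
      rw [h12, neg_le_neg_iff, div_le_div_iff₀ hl'0 (by positivity)]
      have : (l' - l) * x ^ 5 ≤ 2 * x * x ^ 5 := by gcongr; linarith
      have : 2 * x * x ^ 5 = 2 * l := by rw [hl]; ring
      linarith
    have h13 := one_add_mul_le_pow (a := l / l' - 1) (by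
      have : 0 < l / l' := by positivity
      linarith) (2 * K)
    rw [add_sub_cancel] at h13
    refine le_trans ?_ h13
    have : (2 * K : ℝ) * -(2 / x ^ 5) ≤ (2 * K : ℝ) * (l / l' - 1) := by gcongr
    push_cast
    calc 1 - 4 * K / x ^ 5 = 1 + (2 * K : ℝ) * -(2 / x ^ 5) := by ring
      _ ≤ _ := by linarith
  have hfin : 4 * K / x ^ 5 ≤ c₁ / x ^ 4 := by
    rw [div_le_iff₀ hc₁0] at hxK
    rw [div_le_div_iff₀ (by positivity) (by positivity)]
    have : 4 * K * x ^ 4 ≤ x * c₁ * x ^ 4 := by gcongr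
    linarith [this, (by ring : x * c₁ * x ^ 4 = c₁ * x ^ 5)]
  linarith

/-- Contraction holds for exact trajectories only, so the perturbed sequence is compared on each
block with a noise-free one restarted from it at time `a`. -/
theorem exists_trajectory (A : ℕ → H →ₗ[ℝ] H) (a : ℕ) (z : H) :
    ∃ v : ℕ → H, v a = z ∧ ∀ j, a ≤ j → v (j + 1) = v j - A j (v j) := by
  refine ⟨fun j => Nat.rec z (fun i w => w - A (a + i) w) (j - a), by simp, fun j hj => ?_⟩
  obtain ⟨i, rfl⟩ := Nat.exists_eq_add_of_le hj
  simp [add_assoc]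

/-- Each `1 - A j` is nonexpansive, so the one-step defects accumulate without amplification. -/
theorem norm_sub_le_of_nonexpansive {A : ℕ → H →ₗ[ℝ] H}
    (hA : ∀ j v, ‖A j v‖ ^ 2 ≤ ⟪v, A j v⟫) {Z v : ℕ → H} {E : ℕ → ℝ}
    (hZ : ∀ k, ‖Z (k + 1) - (Z k - A k (Z k))‖ ≤ E k) {a b : ℕ} (hab : a ≤ b)
    (hva : v a = Z a) (hv : ∀ j, a ≤ j → v (j + 1) = v j - A j (v j)) :
    ‖Z b - v b‖ ≤ ∑ j ∈ Finset.Ico a b, E j := by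
  induction b, hab using Nat.le_induction with
  | base => simp [hva]
  | succ b hb ih =>
    rw [Finset.sum_Ico_succ_top hb]
    have h1 : Z (b + 1) - v (b + 1) =
        (Z (b + 1) - (Z b - A b (Z b))) + ((Z b - v b) - A b (Z b - v b)) := by
      rw [hv b hb, map_sub]; abel
    have h2 : ‖(Z b - v b) - A b (Z b - v b)‖ ≤ ‖Z b - v b‖ := by
      refine abs_le_of_sq_le_sq' ?_ (norm_nonneg _) |>.2
      have h3 := hA b (Z b - v b)
      have := norm_sub_sq_le_of_norm_sq_le_inner h3
      nlinarith [sq_nonneg ‖A b (Z b - v b)‖]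
    rw [h1]
    refine (norm_add_le _ _).trans ?_
    linarith [hZ b]

theorem norm_le_of_nonexpansive {A : ℕ → H →ₗ[ℝ] H}
    (hA : ∀ j v, ‖A j v‖ ^ 2 ≤ ⟪v, A j v⟫) {v : ℕ → H} {a b : ℕ} (hab : a ≤ b)
    (hv : ∀ j, a ≤ j → v (j + 1) = v j - A j (v j)) : ‖v b‖ ≤ ‖v a‖ := by
  induction b, hab using Nat.le_induction with
  | base => simp
  | succ b hb ih =>
    refine le_trans ?_ ih
    rw [hv b hb]
    refine abs_le_of_sq_le_sq' ?_ (norm_nonneg _) |>.2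
    have h3 := hA b (v b)
    have := norm_sub_sq_le_of_norm_sq_le_inner h3
    nlinarith [sq_nonneg ‖A b (v b)‖]

/-- `1 - 1/y ≤ log y` telescopes; this makes the total cap of a block proportional to the growth of
`log s`. -/
theorem sum_one_sub_div_le_log {s : ℕ → ℝ} (hs : ∀ k, 0 < s k) {a b : ℕ} (hab : a ≤ b) :
    ∑ j ∈ Finset.Ico a b, (1 - s j / s (j + 1)) ≤ Real.log (s b) - Real.log (s a) := by
  induction b, hab using Nat.le_induction with
  | base => simp
  | succ b hb ih =>
    rw [Finset.sum_Ico_succ_top hb]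
    have := Real.log_le_sub_one_of_pos (div_pos (hs b) (hs (b + 1)))
    rw [Real.log_div (hs b).ne' (hs (b + 1)).ne'] at this
    linarith

/-- A perturbed product of gradient steps decays faster than every power of `1 + log s`, provided
the steps are excited on every block along which `s` grows by a large factor. -/
theorem exists_norm_mul_log_pow_le {s : ℕ → ℝ} (hs0 : 1 ≤ s 0) (hmono : Monotone s)
    (htop : Tendsto s atTop atTop) {M : ℝ} (hM : ∀ k, s (k + 1) ≤ M * s k)
    {A : ℕ → H →ₗ[ℝ] H} {κ : ℝ} (hκ : 0 ≤ κ)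
    (hA : ∀ j v, ‖A j v‖ ^ 2 ≤ ⟪v, A j v⟫)
    (hAκ : ∀ j v, ‖A j v‖ ^ 2 ≤ κ * (1 - s j / s (j + 1)) * ⟪v, A j v⟫)
    {c C : ℝ} (hc : 0 < c) (hC : 0 < C) {k₀ : ℕ}
    (hexc : ∀ a b, k₀ ≤ b → a ≤ b → ∀ v : H,
      c * (1 / (C * (1 + Real.log (s b)) ^ (1 / 3 : ℝ)) - s a / s b) * ‖v‖ ^ 2 ≤
        ∑ j ∈ Finset.Ico a b, ⟪v, A j v⟫)
    {Z : ℕ → H} {E : ℕ → ℝ} (hZ : ∀ k, ‖Z (k + 1) - (Z k - A k (Z k))‖ ≤ E k)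
    {K : ℕ} {B : ℝ} (hB : ∀ k, ∑ j ∈ Finset.range k, (1 + Real.log (s j)) ^ K * E j ≤ B) :
    ∃ C' : ℝ, ∀ k, ‖Z k‖ * (1 + Real.log (s k)) ^ K ≤ C' := by
  have hs1 : ∀ k, 1 ≤ s k := fun k => hs0.trans (hmono (Nat.zero_le k))
  have hspos : ∀ k, 0 < s k := fun k => zero_lt_one.trans_le (hs1 k)
  set l : ℕ → ℝ := fun k => 1 + Real.log (s k) with hl
  have hl1 : ∀ k, 1 ≤ l k := fun k => by
    have := Real.log_nonneg (hs1 k)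
    simp only [hl]; linarith
  have hl0 : ∀ k, 0 < l k := fun k => zero_lt_one.trans_le (hl1 k)
  have hlmono : Monotone l := fun i j hij => by
    have := Real.log_le_log (hspos i) (hmono hij)
    simp only [hl]; linarith
  have hltop : Tendsto l atTop atTop :=
    tendsto_atTop_add_const_left _ _ (Real.tendsto_log_atTop.comp htop)
  have hE0 : ∀ k, 0 ≤ E k := fun k => (norm_nonneg _).trans (hZ k)
  have hMpos : 0 < M := by
    by_contra! h
    have := hM 0
    nlinarith [hspos 0, hspos 1]
  have hlstep : ∀ k, l (k + 1) ≤ l k + Real.log M := fun k => by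
    have := Real.log_le_log (hspos (k + 1)) (hM k)
    rw [Real.log_mul hMpos.ne' (hspos k).ne'] at this
    simp only [hl]; linarith
  obtain ⟨x₀, hx₀, hfac⟩ := exists_block_factor_le K (κ := κ) hc hC
  -- Any exponent below `1/3` for the block length would lose to neither the excitation nor its
  -- denominator; `1/6` keeps `l = x ^ 6` an integer power.
  set x : ℕ → ℝ := fun k => l k ^ (1 / 6 : ℝ) with hx
  have hx6 : ∀ k, l k = x k ^ 6 := fun k => by
    simp only [hx]
    rw [← Real.rpow_natCast, ← Real.rpow_mul (hl0 k).le]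
    norm_num
  have hxtop : Tendsto x atTop atTop :=
    (tendsto_rpow_atTop (by norm_num : (0 : ℝ) < 1 / 6)).comp hltop
  have hev := ((hxtop.eventually_ge_atTop (max x₀ (max 2 (Real.log M)))).and
    (eventually_ge_atTop k₀))
  obtain ⟨k₁, hk₁⟩ := eventually_atTop.1 hev
  have hblock : ∀ a b, k₁ ≤ a → a ≤ b → l a + x a ≤ l b → l b ≤ l a + 2 * x a →
      ∀ v : ℕ → H, (∀ j, a ≤ j → v (j + 1) = v j - A j (v j)) →
        ‖v b‖ * l b ^ K ≤ ‖v a‖ * l a ^ K := by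
    intro a b ha hab h1 h2 v hv
    obtain ⟨hxa, hka⟩ := hk₁ a ha
    have hsab : s a / s b = Real.exp (l a - l b) := by
      simp only [hl]
      rw [add_sub_add_left_eq_sub, Real.exp_sub, Real.exp_log (hspos a), Real.exp_log (hspos b)]
    have h3 := norm_sq_le_of_block (τ := fun j => κ * (1 - s j / s (j + 1)))
      (T := κ * (l b - l a))
      (fun j => mul_nonneg hκ (sub_nonneg.2 ((div_le_one (hspos _)).2 (hmono j.le_succ))))
      hA hAκ hab hv (by
        rw [← Finset.mul_sum]
        refine mul_le_mul_of_nonneg_left ?_ hκ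
        refine (sum_one_sub_div_le_log hspos hab).trans ?_
        simp only [hl]; linarith) (hexc a b (hka.trans hab) hab (v a))
    have h4 := hfac (x a) (l a) (l b) ((le_max_left _ _).trans hxa) (hx6 a) h1 h2
    rw [hsab] at h3
    have h5 : ‖v b‖ ^ 2 ≤ (l a / l b) ^ (2 * K) * ‖v a‖ ^ 2 :=
      h3.trans (mul_le_mul_of_nonneg_right h4 (sq_nonneg _))
    have h6 : ‖v b‖ ≤ (l a / l b) ^ K * ‖v a‖ := by
      refine abs_le_of_sq_le_sq' ?_ (by have := hl0 a; have := hl0 b; positivity) |>.2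
      calc ‖v b‖ ^ 2 ≤ _ := h5
        _ = _ := by rw [mul_pow, ← pow_mul, mul_comm K 2]
    rw [div_pow, div_mul_eq_mul_div, le_div_iff₀ (pow_pos (hl0 b) K)] at h6
    linarith
  set S : ℕ → ℝ := fun k => ∑ j ∈ Finset.range k, l j ^ K * E j with hS
  have hSmono : ∀ a b, a ≤ b → l a ^ K * ∑ j ∈ Finset.Ico a b, E j ≤ S b - S a := by
    intro a b hab
    simp only [hS]
    rw [← Finset.sum_Ico_eq_sub _ hab, Finset.mul_sum]
    refine Finset.sum_le_sum fun j hj => ?_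
    have h1 := hlmono (Finset.mem_Ico.1 hj).1
    have := hE0 j
    have := hl0 a
    gcongr
  -- While `l` at most doubles, moving the weight from time `j` to time `b` costs only `2 ^ K`.
  have hkey : ∀ a b, a ≤ b → l b ≤ 2 * l a →
      l b ^ K * ∑ j ∈ Finset.Ico a b, E j ≤ 2 ^ K * (S b - S a) := by
    intro a b hab h
    have h1 : l b ^ K ≤ 2 ^ K * l a ^ K := by
      rw [← mul_pow]
      exact pow_le_pow_left₀ (hl0 b).le h K
    have h2 : 0 ≤ ∑ j ∈ Finset.Ico a b, E j := Finset.sum_nonneg fun j _ => hE0 j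
    calc l b ^ K * ∑ j ∈ Finset.Ico a b, E j
        ≤ 2 ^ K * l a ^ K * ∑ j ∈ Finset.Ico a b, E j := mul_le_mul_of_nonneg_right h1 h2
      _ = 2 ^ K * (l a ^ K * ∑ j ∈ Finset.Ico a b, E j) := by ring
      _ ≤ _ := mul_le_mul_of_nonneg_left (hSmono a b hab) (by positivity)
  set W := ‖Z k₁‖ * l k₁ ^ K with hW
  have hS0 : ∀ k, 0 ≤ S k := fun k => Finset.sum_nonneg fun j _ =>
    mul_nonneg (pow_nonneg (hl0 j).le K) (hE0 j)
  have hx2 : ∀ a, k₁ ≤ a → 2 * x a ≤ l a := by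
    intro a ha
    have h1 : 2 ≤ x a := ((le_max_left _ _).trans (le_max_right _ _)).trans (hk₁ a ha).1
    rw [hx6 a]
    calc 2 * x a ≤ x a * x a := by gcongr
      _ = x a ^ 2 := by ring
      _ ≤ x a ^ 6 := pow_le_pow_right₀ (by linarith) (by norm_num)
  -- `a` is the last block endpoint before `k`. A block closes once `l` has grown by `x a`; the
  -- overshoot is at most `log M ≤ x a`, hence the upper limit `l a + 2 * x a`. The errors of
  -- successive blocks telescope in `S`.
  have hchain : ∀ k, k₁ ≤ k → ∃ a, k₁ ≤ a ∧ a ≤ k ∧ l k < l a + x a ∧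
      ‖Z a‖ * l a ^ K ≤ W + 2 ^ K * S a := by
    intro k hk
    induction k, hk using Nat.le_induction with
    | base =>
      refine ⟨k₁, le_rfl, le_rfl, ?_, ?_⟩
      · have : 0 < x k₁ := Real.rpow_pos_of_pos (hl0 _) _
        linarith
      · have := mul_nonneg (pow_nonneg (zero_le_two (α := ℝ)) K) (hS0 k₁)
        linarith
    | succ k hk ih =>
      obtain ⟨a, ha, hak, hlk, hWa⟩ := ih
      by_cases hlt : l (k + 1) < l a + x a
      · exact ⟨a, ha, hak.trans k.le_succ, hlt, hWa⟩
      · push Not at hlt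
        have hak' : a ≤ k + 1 := hak.trans k.le_succ
        have hup : l (k + 1) ≤ l a + 2 * x a := by
          have h1 : Real.log M ≤ x a :=
            ((le_max_right _ _).trans (le_max_right _ _)).trans (hk₁ a ha).1
          linarith [hlstep k]
        refine ⟨k + 1, hk.trans k.le_succ, le_rfl, ?_, ?_⟩
        · have : 0 < x (k + 1) := Real.rpow_pos_of_pos (hl0 _) _
          linarith
        · obtain ⟨v, hva, hv⟩ := exists_trajectory A a (Z a)
          have h1 := hblock a (k + 1) ha hak' hlt hup v hv
          have h2 := norm_sub_le_of_nonexpansive hA hZ hak' hva hv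
          have h3 := hkey a (k + 1) hak' (by linarith [hx2 a ha])
          have h4 : ‖Z (k + 1)‖ ≤ ‖v (k + 1)‖ + ∑ j ∈ Finset.Ico a (k + 1), E j := by
            have := norm_add_le (v (k + 1)) (Z (k + 1) - v (k + 1))
            rw [add_sub_cancel] at this
            linarith
          have h5 := mul_le_mul_of_nonneg_right h4 (pow_nonneg (hl0 (k + 1)).le K)
          rw [hva] at h1
          calc _ ≤ _ := h5
            _ = ‖v (k + 1)‖ * l (k + 1) ^ K +
              l (k + 1) ^ K * ∑ j ∈ Finset.Ico a (k + 1), E j := by ring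
            _ ≤ W + 2 ^ K * S a + 2 ^ K * (S (k + 1) - S a) := by linarith
            _ = _ := by ring
  -- In the unfinished block after the last endpoint nonexpansiveness suffices, since `l` has not
  -- doubled.
  have hlarge : ∀ k, k₁ ≤ k → ‖Z k‖ * l k ^ K ≤ 2 ^ K * (W + 2 ^ K * B) + 2 ^ K * B := by
    intro k hk
    obtain ⟨a, ha, hak, hlk, hWa⟩ := hchain k hk
    have hl2 : l k ≤ 2 * l a := by
      have : 0 < x a := Real.rpow_pos_of_pos (hl0 _) _
      linarith [hx2 a ha]
    obtain ⟨v, hva, hv⟩ := exists_trajectory A a (Z a)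
    have h1 := norm_le_of_nonexpansive hA hak hv
    have h2 := norm_sub_le_of_nonexpansive hA hZ hak hva hv
    have h3 := hkey a k hak hl2
    have h4 : ‖Z k‖ ≤ ‖Z a‖ + ∑ j ∈ Finset.Ico a k, E j := by
      have := norm_add_le (v k) (Z k - v k)
      rw [add_sub_cancel] at this
      rw [hva] at h1
      linarith
    have h5 := mul_le_mul_of_nonneg_right h4 (pow_nonneg (hl0 k).le K)
    have h6 : ‖Z a‖ * l k ^ K ≤ 2 ^ K * (‖Z a‖ * l a ^ K) := by
      calc ‖Z a‖ * l k ^ K ≤ ‖Z a‖ * (2 * l a) ^ K := by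
            have := hl0 k
            gcongr
        _ = _ := by rw [mul_pow]; ring
    have h7 : 2 ^ K * (‖Z a‖ * l a ^ K) ≤ 2 ^ K * (W + 2 ^ K * B) := by
      have := hB a
      have : S a ≤ B := this
      refine mul_le_mul_of_nonneg_left (hWa.trans ?_) (by positivity)
      gcongr
    have h8 : 2 ^ K * (S k - S a) ≤ 2 ^ K * B := by
      have h9 : S k ≤ B := hB k
      refine mul_le_mul_of_nonneg_left ?_ (by positivity)
      linarith [hS0 a]
    rw [add_mul] at h5
    linarith
  refine ⟨(2 ^ K * (W + 2 ^ K * B) + 2 ^ K * B) + ∑ k ∈ Finset.range k₁, ‖Z k‖ * l k ^ K,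
    fun k => ?_⟩
  have hnn : ∀ k, 0 ≤ ‖Z k‖ * l k ^ K := fun k =>
    mul_nonneg (norm_nonneg _) (pow_nonneg (hl0 k).le K)
  rcases le_or_gt k₁ k with hk | hk
  · have := hlarge k hk
    have := Finset.sum_nonneg (s := Finset.range k₁) fun k _ => hnn k
    simp only [hl] at *
    linarith
  · have h1 := Finset.single_le_sum (f := fun k => ‖Z k‖ * l k ^ K) (fun k _ => hnn k)
      (Finset.mem_range.2 hk)
    have h2 := (hnn k₁).trans (hlarge k₁ le_rfl)
    simp only [hl] at *
    linarith

end Contraction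

/-! ### Comparison of powers and logarithms, and removal of the noise by summation by parts. -/

section Rates

/-- A discrete form of integrating `s ^ (-1-η)`: relative increments of `s`, damped by a negative
power, are dominated by a telescoping difference. -/
theorem one_sub_div_mul_rpow_neg_le {x y η : ℝ} (hx : 0 < x) (hy : 0 < y) (hη : 0 < η) :
    (1 - x / y) * y ^ (-η) ≤ η⁻¹ * (x ^ (-η) - y ^ (-η)) := by
  have h1 : 1 + η * (1 - x / y) ≤ (x / y) ^ (-η) := by
    have hxy : 0 < x / y := div_pos hx hy
    rw [Real.rpow_def_of_pos hxy]
    have h2 := Real.log_le_sub_one_of_pos hxy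
    have h3 := Real.add_one_le_exp (Real.log (x / y) * -η)
    nlinarith
  rw [Real.div_rpow hx.le hy.le, le_div_iff₀ (Real.rpow_pos_of_pos hy _)] at h1
  rw [inv_mul_eq_div, le_div_iff₀ hη]
  linarith

/-- Powers of logarithms are dominated by small powers. -/
theorem one_add_log_pow_le {K : ℕ} {η : ℝ} (hη : 0 < η) :
    ∃ C : ℝ, 0 < C ∧ ∀ x : ℝ, 1 ≤ x → (1 + Real.log x) ^ K ≤ C * x ^ η := by
  have hK : (0 : ℝ) < K + 1 := by positivity
  set e := η / (K + 1) with he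
  have he0 : 0 < e := div_pos hη hK
  refine ⟨(1 + 1 / e) ^ K, by positivity, fun x hx => ?_⟩
  have hx0 : 0 < x := by linarith
  have h1 : 1 + Real.log x ≤ (1 + 1 / e) * x ^ e := by
    have h2 := Real.log_le_rpow_div hx0.le he0
    have h3 : 1 ≤ x ^ e := Real.one_le_rpow hx he0.le
    have h4 : x ^ e / e = 1 / e * x ^ e := by ring
    rw [h4] at h2
    linarith
  have h0 : 0 ≤ 1 + Real.log x := by linarith [Real.log_nonneg hx]
  calc (1 + Real.log x) ^ K ≤ ((1 + 1 / e) * x ^ e) ^ K := pow_le_pow_left₀ h0 h1 K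
    _ = (1 + 1 / e) ^ K * x ^ (e * K) := by
      rw [mul_pow, ← Real.rpow_natCast (x ^ e), ← Real.rpow_mul hx0.le]
    _ ≤ (1 + 1 / e) ^ K * x ^ η := by
      have : e * K ≤ η := by
        rw [he, div_mul_eq_mul_div, div_le_iff₀ hK]
        nlinarith
      have := Real.rpow_le_rpow_of_exponent_le hx this
      gcongr

/-- With `y = s ^ (-η/2)` the increment is a difference of squares: one factor, at most `2 y j`,
absorbs the logarithms, and the other telescopes. -/
theorem exists_sum_log_pow_mul_sub_le {s : ℕ → ℝ} (hs : ∀ k, 1 ≤ s k) (hmono : Monotone s)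
    {η : ℝ} (hη : 0 < η) (K : ℕ) :
    ∃ B : ℝ, ∀ k, ∑ j ∈ Finset.range k,
      (1 + Real.log (s j)) ^ K * (s j ^ (-η) - s (j + 1) ^ (-η)) ≤ B := by
  obtain ⟨C, hC, hlog⟩ := one_add_log_pow_le (K := K) (half_pos hη)
  refine ⟨2 * C, fun k => ?_⟩
  have hspos : ∀ k, 0 < s k := fun k => zero_lt_one.trans_le (hs k)
  set y : ℕ → ℝ := fun k => s k ^ (-(η / 2)) with hy
  have hy0 : ∀ k, 0 < y k := fun k => Real.rpow_pos_of_pos (hspos k) _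
  have hysq : ∀ k, s k ^ (-η) = y k ^ 2 := fun k => by
    simp only [hy]
    rw [← Real.rpow_natCast, ← Real.rpow_mul (hspos k).le]
    congr 1; push_cast; ring
  have hyanti : ∀ k, y (k + 1) ≤ y k := fun k =>
    Real.rpow_le_rpow_of_nonpos (hspos k) (hmono k.le_succ) (by linarith)
  have hterm : ∀ j, (1 + Real.log (s j)) ^ K * (s j ^ (-η) - s (j + 1) ^ (-η)) ≤
      2 * C * (y j - y (j + 1)) := fun j => by
    have h1 : s j ^ (η / 2) * y j = 1 := by
      simp only [hy]
      rw [← Real.rpow_add (hspos j)]; simp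
    rw [hysq, hysq]
    have h2 : 0 ≤ y j ^ 2 - y (j + 1) ^ 2 := by nlinarith [hyanti j, hy0 j, hy0 (j + 1)]
    have h3 : 0 < s j ^ (η / 2) := Real.rpow_pos_of_pos (hspos j) _
    calc _ ≤ C * s j ^ (η / 2) * (y j ^ 2 - y (j + 1) ^ 2) :=
          mul_le_mul_of_nonneg_right (hlog _ (hs j)) h2
      _ = C * (y j - y (j + 1)) * (s j ^ (η / 2) * (y j + y (j + 1))) := by ring
      _ ≤ C * (y j - y (j + 1)) * (s j ^ (η / 2) * (y j + y j)) := by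
        have := hyanti j
        have : 0 ≤ y j - y (j + 1) := by linarith
        gcongr
      _ = 2 * C * (y j - y (j + 1)) * (s j ^ (η / 2) * y j) := by ring
      _ = _ := by rw [h1, mul_one]
  calc _ ≤ ∑ j ∈ Finset.range k, 2 * C * (y j - y (j + 1)) :=
        Finset.sum_le_sum fun j _ => hterm j
    _ = 2 * C * (y 0 - y k) := by rw [← Finset.mul_sum, Finset.sum_range_sub']
    _ ≤ 2 * C := by
      have h1 : y 0 ≤ 1 := Real.rpow_le_one_of_one_le_of_nonpos (hs 0) (by linarith)
      have := hy0 k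
      nlinarith

variable {H : Type*} [NormedAddCommGroup H] [InnerProductSpace ℝ H]

theorem norm_le_of_norm_sq_le_inner {v w : H} {t : ℝ} (h : ‖w‖ ^ 2 ≤ t * ⟪v, w⟫) (ht : 0 ≤ t) :
    ‖w‖ ≤ t * ‖v‖ := by
  rcases (norm_nonneg w).eq_or_lt with h0 | h0
  · rw [← h0]; positivity
  · have h1 : t * ⟪v, w⟫ ≤ t * (‖v‖ * ‖w‖) :=
      mul_le_mul_of_nonneg_left (real_inner_le_norm v w) ht
    nlinarith

/-- Stochastic-gradient errors driven by a noise `w` whose weighted partial sums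
`∑ s_k ^ η • w_k` stay bounded decay faster than every power of `1 + log s`. -/
theorem exists_norm_mul_log_pow_le_of_noise {s : ℕ → ℝ} (hs0 : 1 ≤ s 0) (hmono : Monotone s)
    (htop : Tendsto s atTop atTop) {M : ℝ} (hM : ∀ k, s (k + 1) ≤ M * s k)
    {A : ℕ → H →ₗ[ℝ] H} {κ : ℝ} (hκ : 0 ≤ κ)
    (hA : ∀ j v, ‖A j v‖ ^ 2 ≤ ⟪v, A j v⟫)
    (hAκ : ∀ j v, ‖A j v‖ ^ 2 ≤ κ * (1 - s j / s (j + 1)) * ⟪v, A j v⟫)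
    {c C : ℝ} (hc : 0 < c) (hC : 0 < C) {k₀ : ℕ}
    (hexc : ∀ a b, k₀ ≤ b → a ≤ b → ∀ v : H,
      c * (1 / (C * (1 + Real.log (s b)) ^ (1 / 3 : ℝ)) - s a / s b) * ‖v‖ ^ 2 ≤
        ∑ j ∈ Finset.Ico a b, ⟪v, A j v⟫)
    {Θ w G : ℕ → H} (hΘ : ∀ k, Θ (k + 1) = Θ k - A k (Θ k) - w k) {η : ℝ} (hη : 0 < η)
    (hG : ∀ k, G (k + 1) = G k + s k ^ η • w k) {B : ℝ} (hB : ∀ k, ‖G k‖ ≤ B) (K : ℕ) :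
    ∃ C' : ℝ, ∀ k, ‖Θ k‖ * (1 + Real.log (s k)) ^ K ≤ C' := by
  have hs1 : ∀ k, 1 ≤ s k := fun k => hs0.trans (hmono (Nat.zero_le k))
  have hspos : ∀ k, 0 < s k := fun k => zero_lt_one.trans_le (hs1 k)
  have hB0 : 0 ≤ B := (norm_nonneg _).trans (hB 0)
  have hM1 : 0 < M := by
    by_contra! h
    nlinarith [hspos 0, hspos 1, hM 0]
  set p : ℕ → ℝ := fun k => s k ^ (-η) with hp
  have hp0 : ∀ k, 0 < p k := fun k => Real.rpow_pos_of_pos (hspos k) _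
  have hpanti : ∀ k, p (k + 1) ≤ p k := fun k =>
    Real.rpow_le_rpow_of_nonpos (hspos k) (hmono k.le_succ) (by linarith)
  -- Bounded growth of `s` moves the weight to time `k + 1`, where `one_sub_div_mul_rpow_neg_le`
  -- requires it.
  have hpstep : ∀ k, p k ≤ M ^ η * p (k + 1) := fun k => by
    have h1 : (M * s k) ^ (-η) ≤ p (k + 1) :=
      Real.rpow_le_rpow_of_nonpos (hspos _) (hM k) (by linarith)
    rw [Real.mul_rpow hM1.le (hspos k).le] at h1
    have h2 : M ^ η * M ^ (-η) = 1 := by rw [← Real.rpow_add hM1]; simp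
    have h3 : 0 < M ^ η := Real.rpow_pos_of_pos hM1 _
    calc p k = M ^ η * (M ^ (-η) * s k ^ (-η)) := by rw [← mul_assoc, h2, one_mul]
      _ ≤ _ := by gcongr
  have hpw : ∀ k, p k • (s k ^ η • w k) = w k := fun k => by
    rw [smul_smul]
    simp only [hp]
    rw [← Real.rpow_add (hspos k)]; simp
  -- Since `w k = p k • (G (k+1) - G k)`, this shift leaves only a term in `A k (G k)` and an
  -- increment of `p`, both small because `G` is bounded.
  set Z : ℕ → H := fun k => Θ k + p k • G k with hZ
  set D : ℝ := B * (κ * M ^ η * η⁻¹ + 1) with hD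
  have hdiff : ∀ k, Z (k + 1) - (Z k - A k (Z k)) =
      p k • A k (G k) - (p k - p (k + 1)) • G (k + 1) := fun k => by
    have h1 : w k = p k • (G (k + 1) - G k) := by
      rw [hG k, add_sub_cancel_left, hpw]
    simp only [hZ]
    rw [hΘ k, h1, map_add, map_smul]
    module
  have hAG : ∀ k, ‖A k (G k)‖ ≤ κ * (1 - s k / s (k + 1)) * B := fun k => by
    have h0 : 0 ≤ κ * (1 - s k / s (k + 1)) :=
      mul_nonneg hκ (sub_nonneg.2 ((div_le_one (hspos _)).2 (hmono k.le_succ)))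
    exact (norm_le_of_norm_sq_le_inner (hAκ k (G k)) h0).trans
      (mul_le_mul_of_nonneg_left (hB k) h0)
  have hbound : ∀ k, ‖Z (k + 1) - (Z k - A k (Z k))‖ ≤ D * (p k - p (k + 1)) := fun k => by
    rw [hdiff]
    refine (norm_sub_le _ _).trans ?_
    rw [norm_smul, norm_smul, Real.norm_of_nonneg (hp0 k).le,
      Real.norm_of_nonneg (sub_nonneg.2 (hpanti k))]
    have h0 : 0 ≤ 1 - s k / s (k + 1) :=
      sub_nonneg.2 ((div_le_one (hspos _)).2 (hmono k.le_succ))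
    have h1 : p k * ‖A k (G k)‖ ≤ κ * M ^ η * B * (η⁻¹ * (p k - p (k + 1))) := by
      calc p k * ‖A k (G k)‖ ≤ (M ^ η * p (k + 1)) * (κ * (1 - s k / s (k + 1)) * B) :=
            mul_le_mul (hpstep k) (hAG k) (norm_nonneg _)
              (mul_nonneg (Real.rpow_nonneg hM1.le _) (hp0 _).le)
        _ = κ * M ^ η * B * ((1 - s k / s (k + 1)) * p (k + 1)) := by ring
        _ ≤ _ := by
          have h2 := Real.rpow_nonneg hM1.le η
          exact mul_le_mul_of_nonneg_left
            (one_sub_div_mul_rpow_neg_le (hspos k) (hspos (k + 1)) hη) (by positivity)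
    have h3 : (p k - p (k + 1)) * ‖G (k + 1)‖ ≤ (p k - p (k + 1)) * B :=
      mul_le_mul_of_nonneg_left (hB _) (sub_nonneg.2 (hpanti k))
    rw [hD]
    linarith
  obtain ⟨B₁, hB₁⟩ := exists_sum_log_pow_mul_sub_le hs1 hmono hη K
  have hD0 : 0 ≤ D := by
    have := Real.rpow_nonneg hM1.le η
    positivity
  obtain ⟨C₁, hC₁⟩ := exists_norm_mul_log_pow_le hs0 hmono htop hM hκ hA hAκ hc hC hexc
    (E := fun k => D * (p k - p (k + 1))) hbound (K := K) (B := D * B₁) (fun k => by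
      have := mul_le_mul_of_nonneg_left (hB₁ k) hD0
      rw [Finset.mul_sum] at this
      refine le_trans (le_of_eq (Finset.sum_congr rfl fun j _ => ?_)) this
      ring)
  obtain ⟨C₂, hC₂, hlog⟩ := one_add_log_pow_le (K := K) hη
  refine ⟨C₁ + B * C₂, fun k => ?_⟩
  have h1 : ‖Θ k‖ ≤ ‖Z k‖ + p k * B := by
    have h2 : Θ k = Z k - p k • G k := by simp [hZ]
    rw [h2]
    refine (norm_sub_le _ _).trans ?_
    rw [norm_smul, Real.norm_of_nonneg (hp0 k).le]
    have := mul_le_mul_of_nonneg_left (hB k) (hp0 k).le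
    linarith
  have h3 : p k * (1 + Real.log (s k)) ^ K ≤ C₂ := by
    calc p k * (1 + Real.log (s k)) ^ K ≤ p k * (C₂ * s k ^ η) :=
          mul_le_mul_of_nonneg_left (hlog _ (hs1 k)) (hp0 k).le
      _ = C₂ * (s k ^ (-η) * s k ^ η) := by ring
      _ = C₂ := by rw [← Real.rpow_add (hspos k)]; simp
  have hl0 : 0 ≤ (1 + Real.log (s k)) ^ K :=
    pow_nonneg (by linarith [Real.log_nonneg (hs1 k)]) K
  calc _ ≤ (‖Z k‖ + p k * B) * (1 + Real.log (s k)) ^ K := mul_le_mul_of_nonneg_right h1 hl0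
    _ = ‖Z k‖ * (1 + Real.log (s k)) ^ K + B * (p k * (1 + Real.log (s k)) ^ K) := by ring
    _ ≤ _ := add_le_add (hC₁ k) (mul_le_mul_of_nonneg_left h3 hB0)

end Rates

/-! ### Almost sure convergence of martingale transforms on the event of finite conditional
variance. -/

section MartingaleConvergence

open scoped ENNReal Topology

variable {Ω : Type*} {m0 : MeasurableSpace Ω} {P : Measure Ω} [IsProbabilityMeasure P]

/-- The measures with densities `X` and its conditional expectation agree on the smaller σ-algebra,
hence integrate its measurable functions alike. No integrability is needed. -/
theorem lintegral_mul_condLExp {mΩ : MeasurableSpace Ω} (hm : mΩ ≤ m0) {X f : Ω → ℝ≥0∞}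
    (hX : Measurable[m0] X) (hf : Measurable[mΩ] f) :
    ∫⁻ ω, f ω * (P⁻[X | mΩ]) ω ∂P = ∫⁻ ω, f ω * X ω ∂P := by
  have hV : Measurable[m0] (P⁻[X | mΩ]) := measurable_condLExp' mΩ P X
  have htrim : (P.withDensity X).trim hm = (P.withDensity (P⁻[X | mΩ])).trim hm := by
    refine @Measure.ext _ mΩ _ _ fun s hs => ?_
    rw [trim_measurableSet_eq hm hs, trim_measurableSet_eq hm hs, withDensity_apply _ (hm s hs),
      withDensity_apply _ (hm s hs), setLIntegral_condLExp hm P X hs]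
  have hf' : Measurable[m0] f := hf.mono hm le_rfl
  have h1 : ∫⁻ ω, f ω ∂(P.withDensity X) = ∫⁻ ω, f ω ∂(P.withDensity (P⁻[X | mΩ])) := by
    rw [← lintegral_trim hm hf, htrim, lintegral_trim hm hf]
  rw [lintegral_withDensity_eq_lintegral_mul _ hX hf',
    lintegral_withDensity_eq_lintegral_mul _ hV hf'] at h1
  simp only [Pi.mul_apply] at h1
  simp_rw [mul_comm (f _)]
  exact h1.symm

/-- A martingale with square-summable increments converges almost surely. -/
theorem ae_exists_tendsto_sum_of_sum_integral_sq_le (ℱ : Filtration ℕ m0) {D : ℕ → Ω → ℝ}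
    (hmeas : ∀ k, StronglyMeasurable[ℱ (k + 1)] (D k)) (hL2 : ∀ k, MemLp (D k) 2 P)
    (hcond : ∀ k, P[D k | ℱ k] =ᵐ[P] 0) {R : ℝ}
    (hR : ∀ k, ∑ j ∈ Finset.range k, ∫ ω, D j ω ^ 2 ∂P ≤ R) :
    ∀ᵐ ω ∂P, ∃ c, Tendsto (fun k => ∑ j ∈ Finset.range k, D j ω) atTop (𝓝 c) := by
  set X : ℕ → Ω → ℝ := fun k => ∑ j ∈ Finset.range k, D j with hX
  have hXL2 : ∀ k, MemLp (X k) 2 P := fun k => memLp_finsetSum' _ fun j _ => hL2 j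
  have hXmeas : ∀ k, StronglyMeasurable[ℱ k] (X k) := fun k =>
    Finset.stronglyMeasurable_sum _ fun j hj =>
      (hmeas j).mono (ℱ.mono (Finset.mem_range.1 hj))
  have hXint : ∀ k, Integrable (X k) P := fun k => (hXL2 k).integrable (by norm_num)
  have hDint : ∀ k, Integrable (D k) P := fun k => (hL2 k).integrable (by norm_num)
  have hXsucc : ∀ k, X (k + 1) = X k + D k := fun k => Finset.sum_range_succ _ _
  have hmart : Martingale X ℱ P := by
    refine martingale_of_condExp_sub_eq_zero_nat hXmeas hXint fun k => ?_
    rw [hXsucc, add_sub_cancel_left]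
    exact hcond k
  -- Orthogonality of increments, so the second moment of `X k` is the sum of theirs; the resulting
  -- `L²` bound gives the `L¹` bound for Doob's theorem.
  have hcross : ∀ k, ∫ ω, X k ω * D k ω ∂P = 0 := fun k => by
    have hint : Integrable (X k * D k) P := (hXL2 k).integrable_mul (hL2 k)
    have h1 := condExp_mul_of_stronglyMeasurable_left (hXmeas k) hint (hDint k)
    have h2 : P[X k * D k | ℱ k] =ᵐ[P] 0 := by
      filter_upwards [h1, hcond k] with ω h3 h4
      rw [h3, Pi.mul_apply, h4]; simp
    calc ∫ ω, X k ω * D k ω ∂P = ∫ ω, (P[X k * D k | ℱ k]) ω ∂P :=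
          (integral_condExp (ℱ.le k)).symm
      _ = 0 := by rw [integral_congr_ae h2]; simp
  have hsq : ∀ k, ∫ ω, X k ω ^ 2 ∂P = ∑ j ∈ Finset.range k, ∫ ω, D j ω ^ 2 ∂P := fun k => by
    induction k with
    | zero => simp [hX]
    | succ k ih =>
      rw [Finset.sum_range_succ, ← ih]
      have hint : Integrable (fun ω => X k ω * D k ω) P := (hXL2 k).integrable_mul (hL2 k)
      have h1 : ∀ ω, X (k + 1) ω ^ 2 = X k ω ^ 2 + 2 * (X k ω * D k ω) + D k ω ^ 2 := fun ω => by
        rw [hXsucc, Pi.add_apply]; ring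
      simp_rw [h1]
      have h2 : Integrable (fun ω => X k ω ^ 2 + 2 * (X k ω * D k ω)) P :=
        (hXL2 k).integrable_sq.add (hint.const_mul 2)
      rw [integral_add h2 (hL2 k).integrable_sq,
        integral_add (hXL2 k).integrable_sq (hint.const_mul 2), integral_const_mul, hcross]
      ring
  have hbdd : ∀ k, eLpNorm (X k) 1 P ≤ ((1 + R).toNNReal : ℝ≥0∞) := fun k => by
    rw [eLpNorm_one_eq_lintegral_enorm, ← ofReal_integral_norm_eq_lintegral_enorm (hXint k)]
    refine ENNReal.ofReal_le_ofReal ?_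
    calc ∫ ω, ‖X k ω‖ ∂P ≤ ∫ ω, (1 + X k ω ^ 2) ∂P := by
          refine integral_mono (hXint k).norm ((integrable_const 1).add (hXL2 k).integrable_sq)
            fun ω => ?_
          simp only [Real.norm_eq_abs]
          nlinarith [sq_abs (X k ω), sq_nonneg (|X k ω| - 1)]
      _ = 1 + ∫ ω, X k ω ^ 2 ∂P := by
        rw [integral_add (integrable_const 1) (hXL2 k).integrable_sq]; simp
      _ ≤ 1 + R := by rw [hsq]; linarith [hR k]
  filter_upwards [hmart.submartingale.exists_ae_tendsto_of_bdd hbdd] with ω hω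
  simpa [hX] using hω

/-- The test includes the current term, so the last retained term still belongs to a sum at most
`M`. This bounds the variance after truncation. -/
theorem sum_ite_le_of_sum_le (c : ℕ → ℝ≥0∞) (M : ℝ≥0∞) (k : ℕ) :
    ∑ j ∈ Finset.range k, (if ∑ i ∈ Finset.range (j + 1), c i ≤ M then c j else 0) ≤ M := by
  classical
  induction k with
  | zero => simp
  | succ k ih =>
    by_cases h : ∑ i ∈ Finset.range (k + 1), c i ≤ M
    · refine le_trans (Finset.sum_le_sum fun j _ => ?_) h
      split_ifs
      · exact le_rfl
      · exact zero_le
    · rw [Finset.sum_range_succ, if_neg h, add_zero]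
      exact ih

/-- **Local convergence of martingale transforms**: the sum `∑ g_j ξ_j` of a martingale difference
sequence `ξ` with predictable weights `g` converges almost surely on the event where its
conditional variance is finite. -/
theorem ae_exists_tendsto_sum_of_tsum_condLExp_ne_top (ℱ : Filtration ℕ m0) {g ξ : ℕ → Ω → ℝ}
    (hg : ∀ k, Measurable[ℱ k] (g k)) (hξ : ∀ k, Measurable[ℱ (k + 1)] (ξ k))
    (hint : ∀ k, Integrable (ξ k) P) (hcond : ∀ k, P[ξ k | ℱ k] =ᵐ[P] 0) :
    ∀ᵐ ω ∂P, ∑' k, ENNReal.ofReal (g k ω ^ 2) *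
        (P⁻[fun ω => ENNReal.ofReal (ξ k ω ^ 2) | ℱ k]) ω ≠ ∞ →
      ∃ c, Tendsto (fun k => ∑ j ∈ Finset.range k, g j ω * ξ j ω) atTop (𝓝 c) := by
  classical
  set V : ℕ → Ω → ℝ≥0∞ := fun k ω => ENNReal.ofReal (g k ω ^ 2) *
        (P⁻[fun ω => ENNReal.ofReal (ξ k ω ^ 2) | ℱ k]) ω with hV
  have hVmeas : ∀ k, Measurable[ℱ k] (V k) := fun k =>
    (ENNReal.measurable_ofReal.comp ((hg k).pow_const 2)).mul (measurable_condLExp _ _ _)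
  -- The weights are switched off once the accumulated conditional variance exceeds `M`. The test at
  -- `j` is `ℱ j`-measurable, so the truncated weights stay predictable and the transform is bounded
  -- in `L²`.
  have hlocal : ∀ M : ℕ, ∀ᵐ ω ∂P, ∃ c, Tendsto (fun k => ∑ j ∈ Finset.range k,
      (if ∑ i ∈ Finset.range (j + 1), V i ω ≤ M then g j ω else 0) * ξ j ω) atTop (𝓝 c) := by
    intro M
    set h : ℕ → Ω → ℝ := fun j ω =>
      if ∑ i ∈ Finset.range (j + 1), V i ω ≤ M then g j ω else 0 with hh
    have hset : ∀ j, MeasurableSet[ℱ j] {ω | ∑ i ∈ Finset.range (j + 1), V i ω ≤ M} := by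
      intro j
      refine @measurableSet_le _ _ _ _ _ (ℱ j) _ _ _ _ _ ?_ measurable_const
      refine Finset.measurable_fun_sum _ fun i hi => ?_
      exact (hVmeas i).mono (ℱ.mono (Nat.lt_succ_iff.1 (Finset.mem_range.1 hi))) le_rfl
    have hhmeas : ∀ j, Measurable[ℱ j] (h j) := fun j =>
      Measurable.ite (hset j) (hg j) measurable_const
    have hDmeas : ∀ j, Measurable[ℱ (j + 1)] (fun ω => h j ω * ξ j ω) := fun j =>
      ((hhmeas j).mono (ℱ.mono j.le_succ) le_rfl).mul (hξ j)
    have hsq : ∀ j, ∫⁻ ω, ENNReal.ofReal ((h j ω * ξ j ω) ^ 2) ∂P =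
        ∫⁻ ω, (if ∑ i ∈ Finset.range (j + 1), V i ω ≤ M then V j ω else 0) ∂P := by
      intro j
      have h1 := lintegral_mul_condLExp (P := P) (ℱ.le j)
        (X := fun ω => ENNReal.ofReal (ξ j ω ^ 2)) (f := fun ω => ENNReal.ofReal (h j ω ^ 2))
        (ENNReal.measurable_ofReal.comp (((hξ j).mono (ℱ.le _) le_rfl).pow_const 2))
        (ENNReal.measurable_ofReal.comp ((hhmeas j).pow_const 2))
      calc ∫⁻ ω, ENNReal.ofReal ((h j ω * ξ j ω) ^ 2) ∂P
          = ∫⁻ ω, ENNReal.ofReal (h j ω ^ 2) * ENNReal.ofReal (ξ j ω ^ 2) ∂P := by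
            refine lintegral_congr fun ω => ?_
            rw [mul_pow, ENNReal.ofReal_mul (sq_nonneg _)]
        _ = _ := h1.symm
        _ = _ := by
          refine lintegral_congr fun ω => ?_
          simp only [hh, hV]
          split_ifs <;> simp
    have hsum : ∀ k, ∑ j ∈ Finset.range k,
        ∫⁻ ω, ENNReal.ofReal ((h j ω * ξ j ω) ^ 2) ∂P ≤ M := by
      intro k
      simp_rw [hsq]
      rw [← lintegral_finsetSum]
      · calc _ ≤ ∫⁻ _, (M : ℝ≥0∞) ∂P := lintegral_mono fun ω => sum_ite_le_of_sum_le _ _ _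
          _ = M := by simp
      · exact fun j _ => Measurable.ite (ℱ.le j _ (hset j)) ((hVmeas j).mono (ℱ.le j) le_rfl)
          measurable_const
    have hfin : ∀ j, ∫⁻ ω, ENNReal.ofReal ((h j ω * ξ j ω) ^ 2) ∂P ≤ M := fun j =>
      le_trans (Finset.single_le_sum (f := fun j => ∫⁻ ω, ENNReal.ofReal ((h j ω * ξ j ω) ^ 2) ∂P)
        (fun _ _ => zero_le) (Finset.self_mem_range_succ j)) (hsum (j + 1))
    have hDm : ∀ j, Measurable (fun ω => h j ω * ξ j ω) := fun j =>
      (hDmeas j).mono (ℱ.le _) le_rfl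
    have hL2 : ∀ j, MemLp (fun ω => h j ω * ξ j ω) 2 P := fun j => by
      rw [memLp_two_iff_integrable_sq (hDm j).aestronglyMeasurable]
      refine ⟨((hDm j).pow_const 2).aestronglyMeasurable, ?_⟩
      rw [hasFiniteIntegral_iff_ofReal (ae_of_all _ fun ω => sq_nonneg _)]
      exact (hfin j).trans_lt (ENNReal.natCast_lt_top M)
    refine ae_exists_tendsto_sum_of_sum_integral_sq_le ℱ (R := M)
      (fun k => (hDmeas k).stronglyMeasurable) hL2 (fun k => ?_) fun k => ?_
    · have h1 := condExp_mul_of_stronglyMeasurable_left (hhmeas k).stronglyMeasurable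
        ((hL2 k).integrable (by norm_num)) (hint k)
      filter_upwards [h1, hcond k] with ω h2 h3
      refine h2.trans ?_
      rw [Pi.mul_apply, h3]; simp
    · have h1 : ∀ j, ∫ ω, (h j ω * ξ j ω) ^ 2 ∂P =
          (∫⁻ ω, ENNReal.ofReal ((h j ω * ξ j ω) ^ 2) ∂P).toReal := fun j =>
        integral_eq_lintegral_of_nonneg_ae (ae_of_all _ fun ω => sq_nonneg _)
          ((hDm j).pow_const 2).aestronglyMeasurable
      rw [Finset.sum_congr rfl fun j _ => h1 j,
        ← ENNReal.toReal_sum fun j _ => ((hfin j).trans_lt (ENNReal.natCast_lt_top M)).ne]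
      exact ENNReal.toReal_le_of_le_ofReal (Nat.cast_nonneg M) (by simpa using hsum k)
  filter_upwards [ae_all_iff.2 hlocal] with ω hω hfinite
  -- On a path with finite total variance some level `M` is never exceeded, and there truncation
  -- changes nothing.
  obtain ⟨M, hM⟩ := ENNReal.exists_nat_gt hfinite
  obtain ⟨c, hc⟩ := hω M
  refine ⟨c, hc.congr fun k => Finset.sum_congr rfl fun j _ => ?_⟩
  rw [if_pos]
  exact (ENNReal.sum_le_tsum _).trans hM.le

end MartingaleConvergence

/-! ### Powers of the weight matrix, the Laplacian and its spectrum. -/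

namespace SensorGraph

variable {n : ℕ} (W : SensorGraph n)

theorem weight_comm (i j : Fin n) : W.weight i j = W.weight j i := W.symm.apply j i

theorem sum_weight_col (j : Fin n) : ∑ i, W.weight i j = 1 := by
  simp_rw [W.weight_comm _ j]
  exact W.stochastic j

theorem sum_neighbors {E : Type*} [AddCommGroup E] [Module ℝ E] (i : Fin n) (f : Fin n → E) :
    ∑ j ∈ W.neighbors i, W.weight i j • f j = ∑ j, W.weight i j • f j := by
  refine Finset.sum_subset (Finset.subset_univ _) fun j _ hj => ?_
  have h : W.weight i j = 0 := by
    have h1 : ¬ 0 < W.weight i j := by simpa [neighbors] using hj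
    exact le_antisymm (not_lt.1 h1) (W.nonneg i j)
  rw [h, zero_smul]

section Powers

theorem pow_nonneg (q : ℕ) (i j : Fin n) : 0 ≤ (W.weight ^ q) i j := by
  induction q generalizing i j with
  | zero => rw [pow_zero, Matrix.one_apply]; split_ifs <;> norm_num
  | succ q ih =>
    rw [pow_succ, Matrix.mul_apply]
    exact Finset.sum_nonneg fun l _ => mul_nonneg (ih i l) (W.nonneg l j)

theorem sum_pow (q : ℕ) (i : Fin n) : ∑ j, (W.weight ^ q) i j = 1 := by
  induction q generalizing i with
  | zero => simp [Matrix.one_apply]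
  | succ q ih =>
    simp_rw [pow_succ, Matrix.mul_apply]
    rw [Finset.sum_comm]
    simp_rw [← Finset.mul_sum, W.stochastic, mul_one]
    exact ih i

theorem pow_succ_pos {q : ℕ} {i j l : Fin n} (hij : 0 < W.weight i j)
    (h : 0 < (W.weight ^ q) j l) : 0 < (W.weight ^ (q + 1)) i l := by
  rw [pow_succ', Matrix.mul_apply]
  exact (mul_pos hij h).trans_le (Finset.single_le_sum
    (f := fun j => W.weight i j * (W.weight ^ q) j l)
    (fun j _ => mul_nonneg (W.nonneg i j) (W.pow_nonneg q j l)) (Finset.mem_univ j))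

theorem pow_length_pos {i j : Fin n} (p : W.graph.Walk i j) : 0 < (W.weight ^ p.length) i j := by
  induction p with
  | nil => simp
  | cons h p ih => exact W.pow_succ_pos h.2 ih

/-- A shortest walk has length at most `Q`, and the positive diagonal weights pad it to length
exactly `Q`. -/
theorem pow_pos_of_connected (hconn : W.graph.Connected) {Q : ℕ} (hQ : W.graph.diam ≤ Q)
    (i j : Fin n) : 0 < (W.weight ^ Q) i j := by
  obtain ⟨p, hp⟩ := hconn.exists_walk_length_eq_dist i j
  have : Nonempty (Fin n) := ⟨i⟩
  have hle : p.length ≤ Q := by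
    rw [hp]
    exact (SimpleGraph.dist_le_diam (SimpleGraph.connected_iff_ediam_ne_top.1 hconn)).trans hQ
  clear hQ
  induction Q, hle using Nat.le_induction with
  | base => exact W.pow_length_pos p
  | succ q hq ih => exact W.pow_succ_pos (W.self_pos i) ih

theorem minPowerEntry_le (Q : ℕ) (i j : Fin n) : W.minPowerEntry Q ≤ (W.weight ^ Q) i j :=
  (ciInf_le (Set.finite_range _).bddBelow i).trans (ciInf_le (Set.finite_range _).bddBelow j)

theorem minPowerEntry_pos [Nonempty (Fin n)] (hconn : W.graph.Connected) {Q : ℕ}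
    (hQ : W.graph.diam ≤ Q) : 0 < W.minPowerEntry Q := by
  obtain ⟨i, hi⟩ := exists_eq_ciInf_of_finite (f := fun i => ⨅ j, (W.weight ^ Q) i j)
  obtain ⟨j, hj⟩ := exists_eq_ciInf_of_finite (f := fun j => (W.weight ^ Q) i j)
  rw [minPowerEntry, ← hi, ← hj]
  exact W.pow_pos_of_connected hconn hQ i j

end Powers

section Operators

variable {E : Type*} [NormedAddCommGroup E] [InnerProductSpace ℝ E]

/-- The weighted average over the neighbours, `𝒜 ⊗ I`. -/
noncomputable def averageOp : PiLp 2 (fun _ : Fin n => E) →ₗ[ℝ] PiLp 2 (fun _ : Fin n => E) where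
  toFun v := WithLp.toLp 2 fun i => ∑ j, W.weight i j • v j
  map_add' v w := by ext i; simp [Finset.sum_add_distrib]
  map_smul' c v := by
    ext i
    simp [Finset.smul_sum, smul_comm c]

/-- The Laplacian `L ⊗ I`. -/
noncomputable def laplaceOp : PiLp 2 (fun _ : Fin n => E) →ₗ[ℝ] PiLp 2 (fun _ : Fin n => E) :=
  LinearMap.id - W.averageOp

@[simp]
theorem averageOp_apply (v : PiLp 2 (fun _ : Fin n => E)) (i : Fin n) :
    W.averageOp v i = ∑ j, W.weight i j • v j := rfl

theorem laplaceOp_apply (v : PiLp 2 (fun _ : Fin n => E)) (i : Fin n) :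
    W.laplaceOp v i = v i - ∑ j, W.weight i j • v j := rfl

theorem laplaceOp_apply_eq_sum (v : PiLp 2 (fun _ : Fin n => E)) (i : Fin n) :
    W.laplaceOp v i = ∑ j, W.weight i j • (v i - v j) := by
  simp_rw [smul_sub]
  rw [Finset.sum_sub_distrib, ← Finset.sum_smul, W.stochastic, one_smul, laplaceOp_apply]

theorem inner_averageOp (v w : PiLp 2 (fun _ : Fin n => E)) :
    ⟪v, W.averageOp w⟫ = ⟪W.averageOp v, w⟫ := by
  simp only [PiLp.inner_apply, averageOp_apply, inner_sum, sum_inner, inner_smul_left,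
    inner_smul_right]
  rw [Finset.sum_comm]
  refine Finset.sum_congr rfl fun i _ => Finset.sum_congr rfl fun j _ => ?_
  rw [W.weight_comm]; simp

theorem inner_laplaceOp (v w : PiLp 2 (fun _ : Fin n => E)) :
    ⟪v, W.laplaceOp w⟫ = ⟪W.laplaceOp v, w⟫ := by
  simp [laplaceOp, inner_sub_left, inner_sub_right, inner_averageOp]

theorem two_mul_inner_laplaceOp_self (v : PiLp 2 (fun _ : Fin n => E)) :
    2 * ⟪v, W.laplaceOp v⟫ = ∑ i, ∑ j, W.weight i j * ‖v i - v j‖ ^ 2 := by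
  have h1 : ∑ i, ∑ j, W.weight i j * ‖v i‖ ^ 2 = ∑ i, ‖v i‖ ^ 2 :=
    Finset.sum_congr rfl fun i _ => by rw [← Finset.sum_mul, W.stochastic, one_mul]
  have h2 : ∑ i, ∑ j, W.weight i j * ‖v j‖ ^ 2 = ∑ i, ‖v i‖ ^ 2 := by
    rw [Finset.sum_comm]
    exact Finset.sum_congr rfl fun i _ => by rw [← Finset.sum_mul, W.sum_weight_col, one_mul]
  have h3 : ∑ i, ∑ j, W.weight i j * ‖v i - v j‖ ^ 2 = ∑ i, ∑ j, W.weight i j * ‖v i‖ ^ 2 +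
      ∑ i, ∑ j, W.weight i j * ‖v j‖ ^ 2 - 2 * ∑ i, ∑ j, W.weight i j * ⟪v i, v j⟫ := by
    simp_rw [Finset.mul_sum, ← Finset.sum_add_distrib, ← Finset.sum_sub_distrib]
    refine Finset.sum_congr rfl fun i _ => Finset.sum_congr rfl fun j _ => ?_
    rw [norm_sub_sq_real]; ring
  rw [h3, h1, h2]
  simp only [PiLp.inner_apply, laplaceOp_apply, inner_sub_right, inner_sum, inner_smul_right,
    real_inner_self_eq_norm_sq, Finset.sum_sub_distrib]
  ring

/-- The Dirichlet form vanishes, so values agree across each edge and then along walks. -/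
theorem eq_of_laplaceOp_eq_zero (hconn : W.graph.Connected) {v : PiLp 2 (fun _ : Fin n => E)}
    (hv : W.laplaceOp v = 0) (i j : Fin n) : v i = v j := by
  have h0 := W.two_mul_inner_laplaceOp_self v
  rw [hv, inner_zero_right, mul_zero] at h0
  have hterm : ∀ i j, 0 ≤ W.weight i j * ‖v i - v j‖ ^ 2 := fun i j =>
    mul_nonneg (W.nonneg i j) (sq_nonneg _)
  have hadj : ∀ i j, 0 < W.weight i j → v i = v j := fun i j hij => by
    have h1 := (Finset.sum_eq_zero_iff_of_nonneg fun i _ =>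
      Finset.sum_nonneg fun j _ => hterm i j).1 h0.symm i (Finset.mem_univ i)
    have h2 := (Finset.sum_eq_zero_iff_of_nonneg fun j _ => hterm i j).1 h1 j (Finset.mem_univ j)
    have h3 : ‖v i - v j‖ ^ 2 = 0 := (mul_eq_zero.1 h2).resolve_left hij.ne'
    exact sub_eq_zero.1 (norm_eq_zero.1 (pow_eq_zero_iff two_ne_zero |>.1 h3))
  obtain ⟨p⟩ := hconn i j
  induction p with
  | nil => rfl
  | cons h p ih => exact (hadj _ _ h.2).trans ih

/-- Jensen on each row, then column sums equal to one. -/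
theorem norm_averageOp_le (v : PiLp 2 (fun _ : Fin n => E)) : ‖W.averageOp v‖ ≤ ‖v‖ := by
  refine abs_le_of_sq_le_sq' ?_ (norm_nonneg _) |>.2
  rw [PiLp.norm_sq_eq_of_L2, PiLp.norm_sq_eq_of_L2]
  have h1 : ∀ i, ‖W.averageOp v i‖ ^ 2 ≤ ∑ j, W.weight i j * ‖v j‖ ^ 2 := fun i => by
    have h2 : ‖W.averageOp v i‖ ≤ ∑ j, W.weight i j * ‖v j‖ := by
      rw [averageOp_apply]
      refine (norm_sum_le _ _).trans (Finset.sum_le_sum fun j _ => ?_)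
      rw [norm_smul, Real.norm_of_nonneg (W.nonneg i j)]
    calc _ ≤ (∑ j, W.weight i j * ‖v j‖) ^ 2 := pow_le_pow_left₀ (norm_nonneg _) h2 2
      _ ≤ (∑ j, W.weight i j) * ∑ j, W.weight i j * ‖v j‖ ^ 2 :=
        Finset.sum_sq_le_sum_mul_sum_of_sq_le_mul _ (fun j _ => W.nonneg i j)
          (fun j _ => mul_nonneg (W.nonneg i j) (sq_nonneg _)) fun j _ => le_of_eq (by ring)
      _ = _ := by rw [W.stochastic, one_mul]
  calc _ ≤ ∑ i, ∑ j, W.weight i j * ‖v j‖ ^ 2 := Finset.sum_le_sum fun i _ => h1 i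
    _ = _ := by
      rw [Finset.sum_comm]
      exact Finset.sum_congr rfl fun j _ => by rw [← Finset.sum_mul, W.sum_weight_col, one_mul]

theorem norm_laplaceOp_le (v : PiLp 2 (fun _ : Fin n => E)) : ‖W.laplaceOp v‖ ≤ 2 * ‖v‖ := by
  have h1 : ‖v - W.averageOp v‖ ≤ ‖v‖ + ‖W.averageOp v‖ := norm_sub_le _ _
  have h2 := W.norm_averageOp_le v
  change ‖v - W.averageOp v‖ ≤ _
  linarith

/-- On a connected graph the Laplacian controls the deviation from the mean. -/
theorem exists_sum_norm_sub_mean_sq_le [FiniteDimensional ℝ E] [Nonempty (Fin n)]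
    (hconn : W.graph.Connected) :
    ∃ C : ℝ, 0 < C ∧ ∀ v : PiLp 2 (fun _ : Fin n => E),
      ∑ i, ‖v i - (n : ℝ)⁻¹ • ∑ j, v j‖ ^ 2 ≤ C * ‖W.laplaceOp v‖ ^ 2 := by
  have hn : (n : ℝ) ≠ 0 := by
    have : 0 < Fintype.card (Fin n) := Fintype.card_pos
    rw [Fintype.card_fin] at this
    exact_mod_cast this.ne'
  let S : PiLp 2 (fun _ : Fin n => E) →ₗ[ℝ] E :=
    { toFun := fun v => ∑ j, v j
      map_add' := fun v w => by simp [Finset.sum_add_distrib]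
      map_smul' := fun c v => by simp [Finset.smul_sum] }
  have hS : ∀ v, S v = ∑ j, v j := fun v => rfl
  -- A vector that is constant across sensors and has zero sum vanishes, so `v ↦ (L v, ∑ v)` is
  -- injective; in finite dimension it is bounded below. Applied to the centred vector, it gives the
  -- constant.
  obtain ⟨K, hK, hanti⟩ := LinearMap.exists_antilipschitzWith (W.laplaceOp.prod S) (by
    rw [LinearMap.ker_eq_bot']
    intro v hv
    obtain ⟨h1, h2⟩ := Prod.ext_iff.1 hv
    change W.laplaceOp v = 0 at h1
    change S v = 0 at h2
    ext i
    have h3 : ∑ j, v j = (n : ℝ) • v i := by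
      rw [Finset.sum_congr rfl fun j _ => W.eq_of_laplaceOp_eq_zero hconn h1 j i]
      simp [← Nat.cast_smul_eq_nsmul ℝ]
    rw [hS, h3] at h2
    exact (smul_eq_zero.1 h2).resolve_left hn)
  refine ⟨K ^ 2, by positivity, fun v => ?_⟩
  set w : PiLp 2 (fun _ : Fin n => E) :=
    WithLp.toLp 2 fun i => v i - (n : ℝ)⁻¹ • ∑ j, v j with hw
  have hwi : ∀ i, w i = v i - (n : ℝ)⁻¹ • ∑ j, v j := fun i => rfl
  have hSw : S w = 0 := by
    rw [hS]
    simp_rw [hwi]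
    rw [Finset.sum_sub_distrib, Finset.sum_const, Finset.card_univ, Fintype.card_fin,
      ← Nat.cast_smul_eq_nsmul ℝ, smul_smul, mul_inv_cancel₀ hn, one_smul, sub_self]
  have hLw : W.laplaceOp w = W.laplaceOp v := by
    ext i
    simp only [laplaceOp_apply_eq_sum, hwi, sub_sub_sub_cancel_right]
  have hprod : (W.laplaceOp.prod S) w = (W.laplaceOp v, 0) := Prod.ext hLw hSw
  have h1 := hanti.le_mul_norm_sub w 0
  rw [map_zero, add_zero, add_zero, norm_neg, norm_neg, hprod, Prod.norm_mk, norm_zero,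
    max_eq_left (norm_nonneg _)] at h1
  calc _ = ‖w‖ ^ 2 := by rw [PiLp.norm_sq_eq_of_L2]
    _ ≤ (K * ‖W.laplaceOp v‖) ^ 2 := pow_le_pow_left₀ (norm_nonneg _) h1 2
    _ = _ := by ring

end Operators

theorem laplacian_mulVec_eq (v : EuclideanSpace ℝ (Fin n)) :
    Matrix.mulVec W.laplacian v.ofLp = (W.laplaceOp (E := ℝ) v).ofLp := by
  funext i
  rw [laplacian, Matrix.sub_mulVec, Matrix.one_mulVec, Pi.sub_apply, Matrix.mulVec, dotProduct]
  simp [laplaceOp_apply]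

/-- Were the second smallest eigenvalue zero, so would be the smallest, and two orthonormal
eigenvectors would both be constant across nodes, which is impossible. -/
theorem algebraicConnectivity_ne_zero (hconn : W.graph.Connected) (hn : 2 ≤ n) :
    W.algebraicConnectivity hn ≠ 0 := by
  intro h0
  set hL := W.laplacian_isHermitian
  set e := (Fintype.equivOfCardEq (Fintype.card_fin (Fintype.card (Fin n))) :
    Fin (Fintype.card (Fin n)) ≃ Fin n)
  have heig : ∀ k, hL.eigenvalues (e k) = hL.eigenvalues₀ k := fun k => by
    rw [Matrix.IsHermitian.eigenvalues, Equiv.symm_apply_apply]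
  have hlap : ∀ i, W.laplaceOp (E := ℝ) (hL.eigenvectorBasis i) =
      hL.eigenvalues i • hL.eigenvectorBasis i := fun i => by
    have := hL.mulVec_eigenvectorBasis i
    rw [laplacian_mulVec_eq] at this
    ext j
    exact congrFun this j
  have hnn : ∀ i, 0 ≤ hL.eigenvalues i := fun i => by
    have h1 := W.two_mul_inner_laplaceOp_self (E := ℝ) (hL.eigenvectorBasis i)
    rw [hlap, inner_smul_right, real_inner_self_eq_norm_sq, hL.eigenvectorBasis.norm_eq_one] at h1
    have h2 : 0 ≤ ∑ a, ∑ b, W.weight a b *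
        ‖hL.eigenvectorBasis i a - hL.eigenvectorBasis i b‖ ^ 2 :=
      Finset.sum_nonneg fun a _ => Finset.sum_nonneg fun b _ =>
        mul_nonneg (W.nonneg a b) (sq_nonneg _)
    linarith
  set p : Fin (Fintype.card (Fin n)) := ⟨n - 2, by rw [Fintype.card_fin]; omega⟩ with hp
  set q : Fin (Fintype.card (Fin n)) := ⟨n - 1, by rw [Fintype.card_fin]; omega⟩ with hq
  have hpq : p ≠ q := by
    simp only [hp, hq, ne_eq, Fin.mk.injEq]; omega
  have hp0 : hL.eigenvalues (e p) = 0 := by rw [heig]; exact h0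
  have hq0 : hL.eigenvalues (e q) = 0 := by
    refine le_antisymm ?_ (hnn _)
    rw [heig, ← h0]
    exact hL.eigenvalues₀_antitone (by simp only [hq, Fin.mk_le_mk]; omega)
  set u := hL.eigenvectorBasis (e p)
  set v := hL.eigenvectorBasis (e q)
  have hu : W.laplaceOp (E := ℝ) u = 0 := by rw [hlap, hp0, zero_smul]
  have hv : W.laplaceOp (E := ℝ) v = 0 := by rw [hlap, hq0, zero_smul]
  let z : Fin n := ⟨0, by omega⟩
  have hcu : ∀ i, u i = u z := fun i => W.eq_of_laplaceOp_eq_zero (E := ℝ) hconn hu i z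
  have hcv : ∀ i, v i = v z := fun i => W.eq_of_laplaceOp_eq_zero (E := ℝ) hconn hv i z
  have hne : ∀ w : EuclideanSpace ℝ (Fin n), ‖w‖ = 1 → (∀ i, w i = w z) → w z ≠ 0 := by
    intro w hw hc h
    have : w = 0 := by ext i; rw [hc i, h]; rfl
    rw [this, norm_zero] at hw
    exact zero_ne_one hw
  have horth : ⟪u, v⟫ = 0 :=
    hL.eigenvectorBasis.orthonormal.2 fun h => hpq (e.injective h)
  rw [PiLp.inner_apply, Finset.sum_congr rfl fun i _ => by rw [hcu i, hcv i]] at horth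
  have hn0 : (n : ℝ) ≠ 0 := by
    have : n ≠ 0 := by omega
    exact_mod_cast this
  simp only [Finset.sum_const, Finset.card_univ, Fintype.card_fin, nsmul_eq_mul, mul_eq_zero, hn0,
    false_or] at horth
  have h1 := hne u (hL.eigenvectorBasis.norm_eq_one _) hcu
  have h2 := hne v (hL.eigenvectorBasis.norm_eq_one _) hcv
  simp [h1, h2] at horth

theorem couplingConstant_pos [Nonempty (Fin n)] (hconn : W.graph.Connected) {Q : ℕ}
    (hQ : W.graph.diam ≤ Q) {ν : ℝ} (hν : 0 < ν) : 0 < W.couplingConstant Q ν := by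
  rw [couplingConstant]
  split_ifs with hn
  · have h1 : 0 < W.algebraicConnectivity hn ^ 2 :=
      sq_pos_of_ne_zero (W.algebraicConnectivity_ne_zero hconn hn)
    have h2 := W.minPowerEntry_pos hconn hQ
    have h3 : (0 : ℝ) < n := by
      have : 0 < n := by omega
      exact_mod_cast this
    positivity
  · exact one_pos

end SensorGraph

/-! ### The update operator: its step bound and its excitation. -/

section BlockOperators

variable {n : ℕ} {E : Type*} [NormedAddCommGroup E] [InnerProductSpace ℝ E]

/-- Block-diagonal scaling by the scalars `x i`. -/
noncomputable def scaleOp (x : Fin n → ℝ) :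
    PiLp 2 (fun _ : Fin n => E) →ₗ[ℝ] PiLp 2 (fun _ : Fin n => E) where
  toFun v := WithLp.toLp 2 fun i => x i • v i
  map_add' v w := by ext i; simp
  map_smul' c v := by ext i; simp [smul_comm c]

theorem scaleOp_apply (x : Fin n → ℝ) (v : PiLp 2 (fun _ : Fin n => E)) (i : Fin n) :
    scaleOp x v i = x i • v i := rfl

/-- The block-diagonal operator with blocks `φ i (φ i)ᵀ / r i`. -/
noncomputable def rankOneOp (φ : Fin n → E) (r : Fin n → ℝ) :
    PiLp 2 (fun _ : Fin n => E) →ₗ[ℝ] PiLp 2 (fun _ : Fin n => E) where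
  toFun v := WithLp.toLp 2 fun i => (⟪φ i, v i⟫ / r i) • φ i
  map_add' v w := by ext i; simp [inner_add_right, add_div, add_smul]
  map_smul' c v := by ext i; simp [inner_smul_right, mul_div_assoc, mul_smul]

theorem rankOneOp_apply (φ : Fin n → E) (r : Fin n → ℝ) (v : PiLp 2 (fun _ : Fin n => E))
    (i : Fin n) : rankOneOp φ r v i = (⟪φ i, v i⟫ / r i) • φ i := rfl

theorem inner_scaleOp (x : Fin n → ℝ) (v : PiLp 2 (fun _ : Fin n => E)) :
    ⟪v, scaleOp x v⟫ = ∑ i, x i * ‖v i‖ ^ 2 := by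
  simp [PiLp.inner_apply, scaleOp_apply, inner_smul_right]

theorem inner_rankOneOp (φ : Fin n → E) (r : Fin n → ℝ) (v : PiLp 2 (fun _ : Fin n => E)) :
    ⟪v, rankOneOp φ r v⟫ = ∑ i, ⟪φ i, v i⟫ ^ 2 / r i := by
  simp only [PiLp.inner_apply, rankOneOp_apply, inner_smul_right]
  refine Finset.sum_congr rfl fun i _ => ?_
  rw [real_inner_comm (φ i) (v i)]; ring

theorem norm_scaleOp_sq_le {x : Fin n → ℝ} {t : ℝ} (hx0 : ∀ i, 0 ≤ x i) (hxt : ∀ i, x i ≤ t)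
    (v : PiLp 2 (fun _ : Fin n => E)) : ‖scaleOp x v‖ ^ 2 ≤ t * ⟪v, scaleOp x v⟫ := by
  rw [inner_scaleOp, PiLp.norm_sq_eq_of_L2, Finset.mul_sum]
  refine Finset.sum_le_sum fun i _ => ?_
  rw [scaleOp_apply, norm_smul, mul_pow, Real.norm_eq_abs, sq_abs]
  have : x i * (x i * ‖v i‖ ^ 2) ≤ t * (x i * ‖v i‖ ^ 2) :=
    mul_le_mul_of_nonneg_right (hxt i) (mul_nonneg (hx0 i) (sq_nonneg _))
  linarith

theorem norm_rankOneOp_sq_le {φ : Fin n → E} {r : Fin n → ℝ} {t : ℝ} (hr : ∀ i, 0 < r i)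
    (ht : ∀ i, ‖φ i‖ ^ 2 / r i ≤ t) (v : PiLp 2 (fun _ : Fin n => E)) :
    ‖rankOneOp φ r v‖ ^ 2 ≤ t * ⟪v, rankOneOp φ r v⟫ := by
  rw [inner_rankOneOp, PiLp.norm_sq_eq_of_L2, Finset.mul_sum]
  refine Finset.sum_le_sum fun i _ => ?_
  rw [rankOneOp_apply, norm_smul, mul_pow, Real.norm_eq_abs, sq_abs]
  have h0 := hr i
  have h1 : ‖φ i‖ ^ 2 / r i * (⟪φ i, v i⟫ ^ 2 / r i) ≤ t * (⟪φ i, v i⟫ ^ 2 / r i) :=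
    mul_le_mul_of_nonneg_right (ht i) (by positivity)
  refine le_trans (le_of_eq ?_) h1
  rw [div_pow]; field_simp

variable (W : SensorGraph n)

/-- The update operator `μ (Φ R⁻¹ Φᵀ + ν L X L)` of the distributed gradient algorithm. -/
noncomputable def gradientOp (μ ν : ℝ) (x : Fin n → ℝ) (φ : Fin n → E) (r : Fin n → ℝ) :
    PiLp 2 (fun _ : Fin n => E) →ₗ[ℝ] PiLp 2 (fun _ : Fin n => E) :=
  μ • (rankOneOp φ r + ν • W.laplaceOp ∘ₗ scaleOp x ∘ₗ W.laplaceOp)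

theorem gradientOp_apply (μ ν : ℝ) (x : Fin n → ℝ) (φ : Fin n → E) (r : Fin n → ℝ)
    (v : PiLp 2 (fun _ : Fin n => E)) : gradientOp W μ ν x φ r v =
      μ • (rankOneOp φ r v + ν • W.laplaceOp (scaleOp x (W.laplaceOp v))) := rfl

theorem inner_gradientOp (μ ν : ℝ) (x : Fin n → ℝ) (φ : Fin n → E) (r : Fin n → ℝ)
    (v : PiLp 2 (fun _ : Fin n => E)) : ⟪v, gradientOp W μ ν x φ r v⟫ =
      μ * (∑ i, ⟪φ i, v i⟫ ^ 2 / r i + ν * ∑ i, x i * ‖W.laplaceOp v i‖ ^ 2) := by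
  rw [gradientOp_apply, inner_smul_right, inner_add_right, inner_smul_right, inner_rankOneOp,
    W.inner_laplaceOp, inner_scaleOp]

theorem norm_add_smul_sq_le {H : Type*} [NormedAddCommGroup H] [InnerProductSpace ℝ H] {t : ℝ}
    (ht : 0 ≤ t) (a b : H) : ‖a + t • b‖ ^ 2 ≤ (1 + t) * (‖a‖ ^ 2 + t * ‖b‖ ^ 2) := by
  have h1 := norm_add_sq_real a (t • b)
  have h2 := norm_sub_sq_real a b
  rw [norm_smul, inner_smul_right, mul_pow, Real.norm_eq_abs, sq_abs] at h1
  have h3 : 0 ≤ t * ‖a - b‖ ^ 2 := by positivity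
  rw [h2] at h3
  nlinarith

/-- Both summands satisfy such a bound, with `t` for the rank-one part and `4 t` for `L X L` because
`‖L‖ ≤ 2`. Combining them costs `1 + 4ν`, which `μ` absorbs. -/
theorem norm_gradientOp_sq_le {μ ν : ℝ} (hμ : 0 ≤ μ) (hν : 0 ≤ ν) (hμν : μ * (1 + 4 * ν) ≤ 1)
    {x : Fin n → ℝ} {φ : Fin n → E} {r : Fin n → ℝ} {t : ℝ} (hr : ∀ i, 0 < r i)
    (ht : ∀ i, ‖φ i‖ ^ 2 / r i ≤ t) (hx0 : ∀ i, 0 ≤ x i) (hxt : ∀ i, x i ≤ t)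
    (v : PiLp 2 (fun _ : Fin n => E)) :
    ‖gradientOp W μ ν x φ r v‖ ^ 2 ≤ t * ⟪v, gradientOp W μ ν x φ r v⟫ := by
  set a := rankOneOp φ r v with ha
  set b := W.laplaceOp (scaleOp x (W.laplaceOp v)) with hb
  have hgr : gradientOp W μ ν x φ r v = μ • (a + ν • b) := rfl
  have h1 : ‖a‖ ^ 2 ≤ t * ⟪v, a⟫ := norm_rankOneOp_sq_le hr ht v
  have h2 : ‖b‖ ^ 2 ≤ 4 * (t * ⟪v, b⟫) := by
    have h3 := W.norm_laplaceOp_le (scaleOp x (W.laplaceOp v))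
    have h4 := norm_scaleOp_sq_le hx0 hxt (W.laplaceOp v)
    have h5 : ⟪v, b⟫ = ⟪W.laplaceOp v, scaleOp x (W.laplaceOp v)⟫ := W.inner_laplaceOp _ _
    rw [h5]
    calc ‖b‖ ^ 2 ≤ (2 * ‖scaleOp x (W.laplaceOp v)‖) ^ 2 :=
          pow_le_pow_left₀ (norm_nonneg _) h3 2
      _ = 4 * ‖scaleOp x (W.laplaceOp v)‖ ^ 2 := by ring
      _ ≤ _ := by linarith
  have h6 : ‖a + ν • b‖ ^ 2 ≤ (1 + 4 * ν) * (t * (⟪v, a⟫ + ν * ⟪v, b⟫)) := by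
    -- Splitting `ν • b` as `4ν • (b / 4)` balances the two constants.
    have h7 := norm_add_smul_sq_le (t := 4 * ν) (by positivity) a ((1 / 4 : ℝ) • b)
    rw [smul_smul, norm_smul] at h7
    have h8 : 4 * ν * (1 / 4) = ν := by ring
    rw [h8, mul_pow] at h7
    refine h7.trans (mul_le_mul_of_nonneg_left ?_ (by positivity))
    norm_num
    have h9 : ν * ‖b‖ ^ 2 ≤ ν * (4 * (t * ⟪v, b⟫)) := mul_le_mul_of_nonneg_left h2 hν
    linarith
  have h10 : 0 ≤ t * (⟪v, a⟫ + ν * ⟪v, b⟫) := by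
    have : (0 : ℝ) < 1 + 4 * ν := by positivity
    by_contra! h
    nlinarith [sq_nonneg ‖a + ν • b‖]
  rw [hgr, norm_smul, mul_pow, inner_smul_right, inner_add_right, inner_smul_right,
    Real.norm_eq_abs, sq_abs]
  calc μ ^ 2 * ‖a + ν • b‖ ^ 2
      ≤ μ ^ 2 * ((1 + 4 * ν) * (t * (⟪v, a⟫ + ν * ⟪v, b⟫))) := by gcongr
    _ = (μ * (1 + 4 * ν)) * (μ * (t * (⟪v, a⟫ + ν * ⟪v, b⟫))) := by ring
    _ ≤ 1 * (μ * (t * (⟪v, a⟫ + ν * ⟪v, b⟫))) := by gcongr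
    _ = _ := by ring

/-- Joint excitation of all sensors transfers to the coupled update operators. -/
theorem exists_sum_inner_gradientOp_ge [FiniteDimensional ℝ E] [Nontrivial E] [Nonempty (Fin n)]
    (hconn : W.graph.Connected) {μ ν a : ℝ} (hμ : 0 < μ) (hν : 0 < ν) (ha : 0 < a) :
    ∃ c : ℝ, 0 < c ∧ ∀ (x r : ℕ → Fin n → ℝ) (φ : ℕ → Fin n → E) (J : Finset ℕ) (lam : ℝ),
      (∀ j i, 0 < r j i) → (∀ j i, a * ∑ l, ‖φ j l‖ ^ 2 / r j l ≤ x j i) →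
      (∀ u : E, lam * ‖u‖ ^ 2 ≤ ∑ j ∈ J, ∑ i, ⟪φ j i, u⟫ ^ 2 / r j i) →
      ∀ v : PiLp 2 (fun _ : Fin n => E),
        c * lam * ‖v‖ ^ 2 ≤ ∑ j ∈ J, ⟪v, gradientOp W μ ν (x j) (φ j) (r j) v⟫ := by
  obtain ⟨K, hK, hmean⟩ := W.exists_sum_norm_sub_mean_sq_le (E := E) hconn
  have hn : (0 : ℝ) < n := by
    have : 0 < Fintype.card (Fin n) := Fintype.card_pos
    rw [Fintype.card_fin] at this
    exact_mod_cast this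
  -- `v` is split into the mean `u` and deviations `w`. Only a fraction `η` of the excitation of `u`
  -- is kept: `η ≤ 1/2` allows this in the square, and `4 η K ≤ ν a` lets the consensus term pay for
  -- the cross terms and still control the deviations.
  set η : ℝ := min (1 / 2) (ν * a / (4 * K)) with hη
  have hη0 : 0 < η := lt_min (by norm_num) (by positivity)
  have hη1 : 2 * η ≤ 1 := by
    have := min_le_left (1 / 2 : ℝ) (ν * a / (4 * K))
    linarith
  have hη2 : 4 * η * K ≤ ν * a := by
    have := min_le_right (1 / 2 : ℝ) (ν * a / (4 * K))
    rw [← hη, le_div_iff₀ (by positivity)] at this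
    linarith
  refine ⟨μ * (η / (2 * n)), by positivity, fun x r φ J lam hr hx hlam v => ?_⟩
  have hd : ∀ j i, 0 ≤ ‖φ j i‖ ^ 2 / r j i := fun j i => div_nonneg (sq_nonneg _) (hr j i).le
  have hx0 : ∀ j i, 0 ≤ x j i := fun j i =>
    (mul_nonneg ha.le (Finset.sum_nonneg fun l _ => hd j l)).trans (hx j i)
  simp_rw [inner_gradientOp]
  rw [← Finset.mul_sum, mul_assoc, mul_assoc]
  refine mul_le_mul_of_nonneg_left ?_ hμ.le
  rw [Finset.sum_add_distrib, ← Finset.mul_sum]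
  have hpos : 0 ≤ ∑ j ∈ J, ∑ i, ⟪φ j i, v i⟫ ^ 2 / r j i +
      ν * ∑ j ∈ J, ∑ i, x j i * ‖W.laplaceOp v i‖ ^ 2 := by
    refine add_nonneg (Finset.sum_nonneg fun j _ => Finset.sum_nonneg fun i _ =>
      div_nonneg (sq_nonneg _) (hr j i).le) (mul_nonneg hν.le (Finset.sum_nonneg fun j _ =>
        Finset.sum_nonneg fun i _ => mul_nonneg (hx0 j i) (sq_nonneg _)))
  rcases le_or_gt lam 0 with hl | hl
  · refine le_trans ?_ hpos
    exact mul_nonpos_of_nonneg_of_nonpos (by positivity)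
      (mul_nonpos_of_nonpos_of_nonneg hl (sq_nonneg _))
  set u : E := (n : ℝ)⁻¹ • ∑ j, v j with hu
  set w : Fin n → E := fun i => v i - u with hw
  set D : ℝ := ∑ i, ‖w i‖ ^ 2 with hD
  set T : ℝ := ∑ j ∈ J, ∑ i, ‖φ j i‖ ^ 2 / r j i with hT
  have hD0 : 0 ≤ D := Finset.sum_nonneg fun i _ => sq_nonneg _
  have hT0 : 0 ≤ T := Finset.sum_nonneg fun j _ => Finset.sum_nonneg fun i _ => hd j i
  -- Testing a unit vector: `T` is at least the excitation level, so the surplus `T * D` also covers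
  -- `lam * D`.
  have hlamT : lam ≤ T := by
    obtain ⟨z, hz⟩ := exists_norm_eq E zero_le_one
    have h1 := hlam z
    rw [hz, one_pow, mul_one] at h1
    refine h1.trans (Finset.sum_le_sum fun j _ => Finset.sum_le_sum fun i _ => ?_)
    have h2 : ⟪φ j i, z⟫ ^ 2 ≤ ‖φ j i‖ ^ 2 := by
      have h3 := abs_real_inner_le_norm (φ j i) z
      rw [hz, mul_one] at h3
      rw [← sq_abs]
      exact pow_le_pow_left₀ (abs_nonneg _) h3 2
    exact div_le_div_of_nonneg_right h2 (hr j i).le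
  have hfirst : η * (lam * ‖u‖ ^ 2) - 2 * η * (T * D) ≤
      ∑ j ∈ J, ∑ i, ⟪φ j i, v i⟫ ^ 2 / r j i := by
    have h1 : ∀ j i, η * (⟪φ j i, u⟫ ^ 2 / r j i) - 2 * η * (‖φ j i‖ ^ 2 / r j i * D) ≤
        ⟪φ j i, v i⟫ ^ 2 / r j i := fun j i => by
      have h2 : ⟪φ j i, v i⟫ = ⟪φ j i, u⟫ + ⟪φ j i, w i⟫ := by
        rw [← inner_add_right]; simp [hw]
      have h3 : ⟪φ j i, w i⟫ ^ 2 ≤ ‖φ j i‖ ^ 2 * D := by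
        have h4 : ‖w i‖ ^ 2 ≤ D :=
          Finset.single_le_sum (f := fun i => ‖w i‖ ^ 2) (fun i _ => sq_nonneg _)
            (Finset.mem_univ i)
        calc ⟪φ j i, w i⟫ ^ 2 ≤ (‖φ j i‖ * ‖w i‖) ^ 2 := by
              rw [← sq_abs]
              exact pow_le_pow_left₀ (abs_nonneg _) (abs_real_inner_le_norm _ _) 2
          _ = ‖φ j i‖ ^ 2 * ‖w i‖ ^ 2 := by ring
          _ ≤ _ := by gcongr
      have h5 : η * ⟪φ j i, u⟫ ^ 2 - 2 * η * (‖φ j i‖ ^ 2 * D) ≤ ⟪φ j i, v i⟫ ^ 2 := by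
        rw [h2]
        set p := ⟪φ j i, u⟫
        set q := ⟪φ j i, w i⟫
        have h6 : 2 * η * q ^ 2 ≤ 2 * η * (‖φ j i‖ ^ 2 * D) := by gcongr
        have h7 : 2 * η * (p + q) ^ 2 ≤ (p + q) ^ 2 := by nlinarith [sq_nonneg (p + q)]
        nlinarith [mul_nonneg hη0.le (sq_nonneg (p + 2 * q))]
      have h8 := div_le_div_of_nonneg_right h5 (hr j i).le
      refine le_trans (le_of_eq ?_) h8
      ring
    calc η * (lam * ‖u‖ ^ 2) - 2 * η * (T * D)
        ≤ η * (∑ j ∈ J, ∑ i, ⟪φ j i, u⟫ ^ 2 / r j i) - 2 * η * (T * D) := by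
          have := mul_le_mul_of_nonneg_left (hlam u) hη0.le
          linarith
      _ = ∑ j ∈ J, ∑ i,
          (η * (⟪φ j i, u⟫ ^ 2 / r j i) - 2 * η * (‖φ j i‖ ^ 2 / r j i * D)) := by
        simp only [hT, Finset.sum_sub_distrib, Finset.mul_sum, Finset.sum_mul]
      _ ≤ _ := Finset.sum_le_sum fun j _ => Finset.sum_le_sum fun i _ => h1 j i
  have hsecond : 4 * η * (T * D) ≤ ν * ∑ j ∈ J, ∑ i, x j i * ‖W.laplaceOp v i‖ ^ 2 := by
    have h1 : a * T * ‖W.laplaceOp v‖ ^ 2 ≤ ∑ j ∈ J, ∑ i, x j i * ‖W.laplaceOp v i‖ ^ 2 := by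
      rw [hT, Finset.mul_sum, Finset.sum_mul]
      refine Finset.sum_le_sum fun j _ => ?_
      rw [PiLp.norm_sq_eq_of_L2, Finset.mul_sum]
      exact Finset.sum_le_sum fun i _ => mul_le_mul_of_nonneg_right (hx j i) (sq_nonneg _)
    have h2 : D ≤ K * ‖W.laplaceOp v‖ ^ 2 := hmean v
    have h3 : 4 * η * (T * D) ≤ 4 * η * (T * (K * ‖W.laplaceOp v‖ ^ 2)) := by gcongr
    have h4 : 4 * η * K * (T * ‖W.laplaceOp v‖ ^ 2) ≤ ν * a * (T * ‖W.laplaceOp v‖ ^ 2) := by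
      gcongr
    have h5 := mul_le_mul_of_nonneg_left h1 hν.le
    linarith
  have hvn : ‖v‖ ^ 2 ≤ 2 * n * (‖u‖ ^ 2 + D) := by
    have h1 : ∀ i, ‖v i‖ ^ 2 ≤ 2 * ‖u‖ ^ 2 + 2 * ‖w i‖ ^ 2 := fun i => by
      have h2 : v i = u + w i := by simp [hw]
      rw [h2]
      have h3 := norm_add_le u (w i)
      have h4 := pow_le_pow_left₀ (norm_nonneg _) h3 2
      nlinarith [sq_nonneg (‖u‖ - ‖w i‖)]
    have hn1 : (1 : ℝ) ≤ n := by
      have : 0 < n := by exact_mod_cast hn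
      exact_mod_cast this
    rw [PiLp.norm_sq_eq_of_L2]
    calc ∑ i, ‖v i‖ ^ 2 ≤ ∑ i, (2 * ‖u‖ ^ 2 + 2 * ‖w i‖ ^ 2) :=
          Finset.sum_le_sum fun i _ => h1 i
      _ = n * (2 * ‖u‖ ^ 2) + 2 * D := by
        rw [Finset.sum_add_distrib, hD, Finset.mul_sum]; simp
      _ ≤ _ := by nlinarith
  calc η / (2 * n) * (lam * ‖v‖ ^ 2) ≤ η / (2 * n) * (lam * (2 * n * (‖u‖ ^ 2 + D))) := by gcongr
    _ = η * (lam * ‖u‖ ^ 2) + η * (lam * D) := by field_simp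
    _ ≤ η * (lam * ‖u‖ ^ 2) + 2 * η * (T * D) := by
      have : lam * D ≤ T * D := by gcongr
      nlinarith [mul_nonneg hT0 hD0]
    _ ≤ _ := by linarith

end BlockOperators

/-! ### Regressor energy, excitation of blocks, diffusion, and the error recursion. -/

namespace DistributedSG

variable {m n : ℕ}

section Regressors

variable (φ : ℕ → Fin n → EuclideanSpace ℝ (Fin m))

theorem one_le_r (k : ℕ) (i : Fin n) : 1 ≤ r φ k i :=
  le_add_of_nonneg_right (Finset.sum_nonneg fun _ _ => sq_nonneg _)

theorem r_pos (k : ℕ) (i : Fin n) : 0 < r φ k i := zero_lt_one.trans_le (one_le_r φ k i)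

theorem r_succ (k : ℕ) (i : Fin n) : r φ (k + 1) i = r φ k i + ‖φ (k + 1) i‖ ^ 2 := by
  rw [r, r, Finset.sum_Icc_succ_top (by omega), add_assoc]

theorem r_mono (i : Fin n) : Monotone fun k => r φ k i :=
  monotone_nat_of_le_succ fun k => by
    rw [r_succ]; exact le_add_of_nonneg_right (sq_nonneg _)

/-- The total energy `∑ᵢ rⁱ_k`, which is the trace of the excitation matrix. -/
noncomputable def totalEnergy (k : ℕ) : ℝ := ∑ i, r φ k i

theorem r_le_totalEnergy (k : ℕ) (i : Fin n) : r φ k i ≤ totalEnergy φ k :=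
  Finset.single_le_sum (f := r φ k) (fun i _ => (r_pos φ k i).le) (Finset.mem_univ i)

theorem totalEnergy_succ (k : ℕ) :
    totalEnergy φ (k + 1) = totalEnergy φ k + ∑ i, ‖φ (k + 1) i‖ ^ 2 := by
  simp only [totalEnergy, r_succ, Finset.sum_add_distrib]

theorem totalEnergy_mono : Monotone (totalEnergy φ) := fun _ _ h =>
  Finset.sum_le_sum fun i _ => r_mono φ i h

theorem one_le_totalEnergy [Nonempty (Fin n)] (k : ℕ) : 1 ≤ totalEnergy φ k :=
  (one_le_r φ k (Classical.arbitrary _)).trans (r_le_totalEnergy φ k _)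

theorem norm_R (k : ℕ) : ‖R φ k‖ = ‖r φ k‖ := Matrix.l2_opNorm_diagonal _

theorem r_le_norm_R (k : ℕ) (i : Fin n) : r φ k i ≤ ‖R φ k‖ := by
  rw [norm_R]
  exact (le_abs_self _).trans (norm_le_pi_norm (r φ k) i)

theorem norm_R_le_of_forall_le {k : ℕ} {C : ℝ} (hC : 0 ≤ C) (h : ∀ i, r φ k i ≤ C) :
    ‖R φ k‖ ≤ C := by
  rw [norm_R, pi_norm_le_iff_of_nonneg hC]
  intro i
  rw [Real.norm_of_nonneg (r_pos φ k i).le]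
  exact h i

theorem norm_R_le_totalEnergy (k : ℕ) : ‖R φ k‖ ≤ totalEnergy φ k :=
  norm_R_le_of_forall_le φ (Finset.sum_nonneg fun i _ => (r_pos φ k i).le)
    fun i => r_le_totalEnergy φ k i

variable {φ}

theorem one_le_of_ratio_le [Nonempty (Fin n)] {γ : ℝ} {k : ℕ}
    (h : (⨆ i, r φ k i) / (⨅ i, r φ k i) ≤ γ) : 1 ≤ γ := by
  refine le_trans ?_ h
  obtain ⟨i, hi⟩ := exists_eq_ciInf_of_finite (f := fun i => r φ k i)
  have h0 : 0 < ⨅ i, r φ k i := hi ▸ r_pos φ k i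
  rw [one_le_div h0, ← hi]
  exact le_ciSup (f := fun i => r φ k i) (Set.finite_range _).bddAbove i

theorem r_le_mul_r_of_ratio_le [Nonempty (Fin n)] {γ : ℝ} {k : ℕ}
    (h : (⨆ i, r φ k i) / (⨅ i, r φ k i) ≤ γ) (i j : Fin n) : r φ k i ≤ γ * r φ k j := by
  have hγ := one_le_of_ratio_le h
  obtain ⟨i₀, hi₀⟩ := exists_eq_ciInf_of_finite (f := fun i => r φ k i)
  have h0 : 0 < ⨅ i, r φ k i := hi₀ ▸ r_pos φ k i₀
  rw [div_le_iff₀ h0] at h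
  calc r φ k i ≤ ⨆ i, r φ k i := le_ciSup (f := fun i => r φ k i) (Set.finite_range _).bddAbove i
    _ ≤ γ * ⨅ i, r φ k i := h
    _ ≤ γ * r φ k j := mul_le_mul_of_nonneg_left
      (ciInf_le (f := fun i => r φ k i) (Set.finite_range _).bddBelow j) (by linarith)

theorem totalEnergy_le_mul_r {γ : ℝ} {k : ℕ} (h : ∀ i j, r φ k i ≤ γ * r φ k j) (j : Fin n) :
    totalEnergy φ k ≤ n * γ * r φ k j := by
  calc totalEnergy φ k ≤ ∑ _i : Fin n, γ * r φ k j := Finset.sum_le_sum fun i _ => h i j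
    _ = _ := by simp [mul_assoc]

end Regressors

section Excitation

variable (φ : ℕ → Fin n → EuclideanSpace ℝ (Fin m))

theorem excitation_isHermitian (k : ℕ) : (excitation φ k).IsHermitian := by
  rw [Matrix.IsHermitian, Matrix.conjTranspose_eq_transpose_of_trivial, excitation]
  simp [Matrix.transpose_sum, Matrix.transpose_vecMulVec]

theorem excitation_dotProduct (k : ℕ) (u : EuclideanSpace ℝ (Fin m)) :
    dotProduct u.ofLp (Matrix.mulVec (excitation φ k) u.ofLp) =
      (n : ℝ) / m * ‖u‖ ^ 2 + ∑ i, ∑ j ∈ Finset.Icc 1 k, ⟪φ j i, u⟫ ^ 2 := by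
  have h1 : ∀ v : EuclideanSpace ℝ (Fin m), dotProduct v.ofLp u.ofLp = ⟪v, u⟫ := fun v => by
    rw [PiLp.inner_apply, dotProduct]
    exact Finset.sum_congr rfl fun i _ => by simp [mul_comm]
  simp only [excitation, Matrix.add_mulVec, Matrix.smul_mulVec, Matrix.one_mulVec,
    Matrix.sum_mulVec, dotProduct_add, dotProduct_smul, dotProduct_sum, Matrix.vecMulVec_mulVec]
  congr 1
  · rw [h1, real_inner_self_eq_norm_sq, smul_eq_mul]
  · refine Finset.sum_congr rfl fun i _ => Finset.sum_congr rfl fun j _ => ?_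
    simp only [op_smul_eq_smul, smul_eq_mul]
    rw [h1, dotProduct_comm, h1, sq]

theorem excitation_trace (hm : 1 ≤ m) (k : ℕ) : (excitation φ k).trace = totalEnergy φ k := by
  have hm0 : (m : ℝ) ≠ 0 := by
    have : m ≠ 0 := by omega
    exact_mod_cast this
  have h1 : ∀ v : EuclideanSpace ℝ (Fin m), dotProduct v.ofLp v.ofLp = ‖v‖ ^ 2 := fun v => by
    rw [EuclideanSpace.real_norm_sq_eq, dotProduct]
    exact Finset.sum_congr rfl fun i _ => by ring
  simp only [excitation, Matrix.trace_add, Matrix.trace_smul, Matrix.trace_one, Matrix.trace_sum,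
    Matrix.trace_vecMulVec, h1, totalEnergy, r, Finset.sum_add_distrib]
  simp [hm0]

theorem lambdaMin_mul_le {A : Matrix (Fin m) (Fin m) ℝ} (hA : A.IsHermitian)
    (u : EuclideanSpace ℝ (Fin m)) :
    lambdaMin A * ‖u‖ ^ 2 ≤ dotProduct u.ofLp (Matrix.mulVec A u.ofLp) := by
  have hps : (A - lambdaMin A • (1 : Matrix (Fin m) (Fin m) ℝ)).PosSemidef := by
    rw [Matrix.posSemidef_iff_isHermitian_and_spectrum_nonneg]
    refine ⟨hA.sub (Matrix.isHermitian_one.smul (IsSelfAdjoint.all _)), fun x hx => ?_⟩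
    rw [← Algebra.algebraMap_eq_smul_one, ← spectrum.sub_singleton_eq, Set.sub_singleton] at hx
    obtain ⟨y, hy, rfl⟩ := hx
    exact sub_nonneg.2 (csInf_le Matrix.finite_real_spectrum.bddBelow hy)
  have h := hps.dotProduct_mulVec_nonneg u.ofLp
  rw [Matrix.sub_mulVec, Matrix.smul_mulVec, Matrix.one_mulVec, dotProduct_sub, dotProduct_smul,
    smul_eq_mul, star_trivial] at h
  have h1 : dotProduct u.ofLp u.ofLp = ‖u‖ ^ 2 := by
    rw [EuclideanSpace.real_norm_sq_eq, dotProduct]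
    exact Finset.sum_congr rfl fun i _ => by ring
  rw [h1] at h
  linarith

theorem trace_le_mul_lambdaMax {A : Matrix (Fin m) (Fin m) ℝ} (hA : A.IsHermitian) :
    A.trace ≤ m * lambdaMax A := by
  rw [hA.trace_eq_sum_eigenvalues]
  calc _ ≤ ∑ _i : Fin m, lambdaMax A := Finset.sum_le_sum fun i _ =>
        le_csSup Matrix.finite_real_spectrum.bddAbove (hA.eigenvalues_mem_spectrum_real i)
    _ = _ := by simp

theorem le_lambdaMin (hm : 1 ≤ m) {A : Matrix (Fin m) (Fin m) ℝ} (hA : A.IsHermitian) {c : ℝ}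
    (h : ∀ u : EuclideanSpace ℝ (Fin m),
      c * ‖u‖ ^ 2 ≤ dotProduct u.ofLp (Matrix.mulVec A u.ofLp)) : c ≤ lambdaMin A := by
  rw [lambdaMin, hA.spectrum_real_eq_range_eigenvalues]
  have : Nonempty (Fin m) := ⟨⟨0, hm⟩⟩
  refine le_ciInf fun i => ?_
  have h1 := h (hA.eigenvectorBasis i)
  rw [hA.mulVec_eigenvectorBasis, dotProduct_smul, hA.eigenvectorBasis.norm_eq_one] at h1
  have h2 : dotProduct (hA.eigenvectorBasis i).ofLp (hA.eigenvectorBasis i).ofLp = 1 := by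
    have h3 : ‖hA.eigenvectorBasis i‖ ^ 2 = 1 := by rw [hA.eigenvectorBasis.norm_eq_one, one_pow]
    rw [EuclideanSpace.real_norm_sq_eq] at h3
    rw [← h3, dotProduct]
    exact Finset.sum_congr rfl fun i _ => by ring
  rw [h2] at h1
  simpa using h1

/-- The quadratic form of the excitation matrix. -/
noncomputable def excitationForm (k : ℕ) (u : EuclideanSpace ℝ (Fin m)) : ℝ :=
  (n : ℝ) / m * ‖u‖ ^ 2 + ∑ i, ∑ j ∈ Finset.Icc 1 k, ⟪φ j i, u⟫ ^ 2

variable {φ}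

theorem excitationForm_le (hm : 1 ≤ m) (k : ℕ) (u : EuclideanSpace ℝ (Fin m)) :
    excitationForm φ k u ≤ totalEnergy φ k * ‖u‖ ^ 2 := by
  have hm1 : (1 : ℝ) ≤ m := by exact_mod_cast hm
  have h1 : (n : ℝ) / m ≤ n := div_le_self (Nat.cast_nonneg n) hm1
  have h2 : totalEnergy φ k = n + ∑ i, ∑ j ∈ Finset.Icc 1 k, ‖φ j i‖ ^ 2 := by
    simp [totalEnergy, r, Finset.sum_add_distrib]
  rw [excitationForm, h2, add_mul, Finset.sum_mul]
  refine add_le_add (mul_le_mul_of_nonneg_right h1 (sq_nonneg _)) (Finset.sum_le_sum fun i _ => ?_)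
  rw [Finset.sum_mul]
  refine Finset.sum_le_sum fun j _ => ?_
  rw [← sq_abs, ← mul_pow]
  exact pow_le_pow_left₀ (abs_nonneg _) (abs_real_inner_le_norm _ _) 2

/-- The trace is the total energy and at most `m` times the largest eigenvalue; the condition number
passes this lower bound to the smallest. The term `(n/m) I` keeps that eigenvalue positive, so the
ratio can be cleared. -/
theorem le_excitationForm [Nonempty (Fin n)] (hm : 1 ≤ m) {N : ℝ} (hN : 0 < N) {k : ℕ}
    (h : lambdaMax (excitation φ k) / lambdaMin (excitation φ k) ≤
      N * (Real.log ‖R φ k‖) ^ (1 / 3 : ℝ)) (u : EuclideanSpace ℝ (Fin m)) :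
    totalEnergy φ k / (m * N * (1 + Real.log (totalEnergy φ k)) ^ (1 / 3 : ℝ)) * ‖u‖ ^ 2 ≤
      excitationForm φ k u := by
  have hA := excitation_isHermitian φ k
  have hm0 : (0 : ℝ) < m := by exact_mod_cast hm
  have hn0 : (0 : ℝ) < n := by
    have : 0 < Fintype.card (Fin n) := Fintype.card_pos
    rw [Fintype.card_fin] at this
    exact_mod_cast this
  have hmin : 0 < lambdaMin (excitation φ k) := by
    refine lt_of_lt_of_le (div_pos hn0 hm0) (le_lambdaMin hm hA fun u => ?_)
    rw [excitation_dotProduct]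
    exact le_add_of_nonneg_right
      (Finset.sum_nonneg fun i _ => Finset.sum_nonneg fun j _ => sq_nonneg _)
  have h1 : 1 ≤ ‖R φ k‖ := (one_le_r φ k (Classical.arbitrary _)).trans (r_le_norm_R φ k _)
  have h2 : Real.log ‖R φ k‖ ≤ 1 + Real.log (totalEnergy φ k) := by
    have := Real.log_le_log (by linarith) (norm_R_le_totalEnergy φ k)
    linarith
  have hl : 0 < 1 + Real.log (totalEnergy φ k) := by
    have := Real.log_nonneg (one_le_totalEnergy φ k)
    linarith
  set L := (1 + Real.log (totalEnergy φ k)) ^ (1 / 3 : ℝ) with hL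
  have hL0 : 0 < L := Real.rpow_pos_of_pos hl _
  have h3 : (Real.log ‖R φ k‖) ^ (1 / 3 : ℝ) ≤ L :=
    Real.rpow_le_rpow (Real.log_nonneg h1) h2 (by norm_num)
  have h4 : lambdaMax (excitation φ k) ≤ N * L * lambdaMin (excitation φ k) := by
    rw [← div_le_iff₀ hmin]
    exact h.trans (mul_le_mul_of_nonneg_left h3 hN.le)
  have h5 := trace_le_mul_lambdaMax hA
  rw [excitation_trace φ hm] at h5
  have h6 : totalEnergy φ k / (m * N * L) ≤ lambdaMin (excitation φ k) := by
    rw [div_le_iff₀ (by positivity)]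
    have := mul_le_mul_of_nonneg_left h4 hm0.le
    linarith
  have h7 := lambdaMin_mul_le hA u
  rw [excitation_dotProduct] at h7
  exact (mul_le_mul_of_nonneg_right h6 (sq_nonneg _)).trans h7

theorem excitationForm_succ (k : ℕ) (u : EuclideanSpace ℝ (Fin m)) :
    excitationForm φ (k + 1) u = excitationForm φ k u + ∑ i, ⟪φ (k + 1) i, u⟫ ^ 2 := by
  rw [excitationForm, excitationForm, add_assoc, ← Finset.sum_add_distrib]
  congr 1
  exact Finset.sum_congr rfl fun i _ => Finset.sum_Icc_succ_top (by omega) _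

theorem excitationForm_sub_le {a b : ℕ} (hab : a ≤ b) (u : EuclideanSpace ℝ (Fin m)) :
    excitationForm φ b u - excitationForm φ a u ≤
      totalEnergy φ b * ∑ j ∈ Finset.Ico a b, ∑ i, ⟪φ (j + 1) i, u⟫ ^ 2 / r φ (j + 1) i := by
  have h1 : excitationForm φ b u - excitationForm φ a u =
      ∑ j ∈ Finset.Ico a b, ∑ i, ⟪φ (j + 1) i, u⟫ ^ 2 := by
    induction b, hab using Nat.le_induction with
    | base => simp
    | succ b hb ih =>
      rw [Finset.sum_Ico_succ_top hb, ← ih, excitationForm_succ]; ring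
  rw [h1, Finset.mul_sum]
  refine Finset.sum_le_sum fun j hj => ?_
  rw [Finset.mul_sum]
  refine Finset.sum_le_sum fun i _ => ?_
  have h2 : r φ (j + 1) i ≤ totalEnergy φ b :=
    (r_le_totalEnergy φ _ i).trans (totalEnergy_mono φ (Finset.mem_Ico.1 hj).2)
  rw [mul_div_assoc', le_div_iff₀ (r_pos φ _ i), mul_comm]
  exact mul_le_mul_of_nonneg_right h2 (sq_nonneg _)

/-- The form at `b` is large by conditioning, the form at `a` is at most `s a`, and every normaliser
inside the block is at most `s b`. -/
theorem block_excitation_ge [Nonempty (Fin n)] (hm : 1 ≤ m) {N : ℝ} (hN : 0 < N) {a b : ℕ}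
    (hab : a ≤ b)
    (h : lambdaMax (excitation φ b) / lambdaMin (excitation φ b) ≤
      N * (Real.log ‖R φ b‖) ^ (1 / 3 : ℝ)) (u : EuclideanSpace ℝ (Fin m)) :
    (1 / (m * N * (1 + Real.log (totalEnergy φ b)) ^ (1 / 3 : ℝ)) -
        totalEnergy φ a / totalEnergy φ b) * ‖u‖ ^ 2 ≤
      ∑ j ∈ Finset.Ico a b, ∑ i, ⟪φ (j + 1) i, u⟫ ^ 2 / r φ (j + 1) i := by
  have hs : 0 < totalEnergy φ b := zero_lt_one.trans_le (one_le_totalEnergy φ b)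
  have h1 := le_excitationForm hm hN h u
  have h2 := excitationForm_le (φ := φ) hm a u
  have h3 := excitationForm_sub_le (φ := φ) hab u
  refine le_of_mul_le_mul_left ?_ hs
  refine le_trans (le_of_eq ?_) (le_trans (sub_le_sub h1 h2) h3)
  field_simp

end Excitation

section Diffusion

variable (W : SensorGraph n) (φ : ℕ → Fin n → EuclideanSpace ℝ (Fin m))

theorem diffusion_eq (k q : ℕ) (i : Fin n) :
    diffusion W φ k q i = ∑ j, (W.weight ^ q) i j * (‖φ k j‖ ^ 2 / r φ k j) := by
  induction q generalizing i with
  | zero => simp [diffusion, Matrix.one_apply]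
  | succ q ih =>
    have h := W.sum_neighbors i (diffusion W φ k q)
    simp only [smul_eq_mul] at h
    rw [diffusion, h]
    simp_rw [ih, pow_succ', Matrix.mul_apply, Finset.sum_mul, Finset.mul_sum]
    rw [Finset.sum_comm]
    refine Finset.sum_congr rfl fun j _ => Finset.sum_congr rfl fun l _ => by ring

theorem diffusion_nonneg (k q : ℕ) (i : Fin n) : 0 ≤ diffusion W φ k q i := by
  rw [diffusion_eq]
  exact Finset.sum_nonneg fun j _ => mul_nonneg (W.pow_nonneg q i j)
    (div_nonneg (sq_nonneg _) (r_pos φ k j).le)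

theorem diffusion_le {k : ℕ} {t : ℝ} (h : ∀ j, ‖φ k j‖ ^ 2 / r φ k j ≤ t) (q : ℕ) (i : Fin n) :
    diffusion W φ k q i ≤ t := by
  rw [diffusion_eq]
  calc _ ≤ ∑ j, (W.weight ^ q) i j * t :=
        Finset.sum_le_sum fun j _ => mul_le_mul_of_nonneg_left (h j) (W.pow_nonneg q i j)
    _ = t := by rw [← Finset.sum_mul, W.sum_pow, one_mul]

/-- Diffusion carries every sensor's excitation to every other, so consensus acts whenever any
regressor is active. -/
theorem minPowerEntry_mul_sum_le_diffusion (k q : ℕ) (i : Fin n) :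
    W.minPowerEntry q * ∑ l, ‖φ k l‖ ^ 2 / r φ k l ≤ diffusion W φ k q i := by
  rw [diffusion_eq, Finset.mul_sum]
  exact Finset.sum_le_sum fun j _ => mul_le_mul_of_nonneg_right (W.minPowerEntry_le q i j)
    (div_nonneg (sq_nonneg _) (r_pos φ k j).le)

end Diffusion

section Dynamics

variable (W : SensorGraph n) (Q : ℕ) (μ ν : ℝ) (θ : EuclideanSpace ℝ (Fin m))
  (φ : ℕ → Fin n → EuclideanSpace ℝ (Fin m)) (noise : ℕ → Fin n → ℝ)
  (init : Fin n → EuclideanSpace ℝ (Fin m))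

/-- The estimation errors of the sensors as a vector of blocks. -/
noncomputable def blockError (k : ℕ) : PiLp 2 (fun _ : Fin n => EuclideanSpace ℝ (Fin m)) :=
  WithLp.toLp 2 fun i => θ - estimate W Q μ ν θ φ noise init k i

/-- The noise entering the algorithm at time `k`. -/
noncomputable def noiseInput (k : ℕ) : PiLp 2 (fun _ : Fin n => EuclideanSpace ℝ (Fin m)) :=
  WithLp.toLp 2 fun i => (μ * noise (k + 1) i / r φ k i) • φ k i

theorem norm_errorVec (k : ℕ) :
    ‖errorVec W Q μ ν θ φ noise init k‖ = ‖blockError W Q μ ν θ φ noise init k‖ := by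
  rw [← sq_eq_sq₀ (norm_nonneg _) (norm_nonneg _), EuclideanSpace.real_norm_sq_eq,
    PiLp.norm_sq_eq_of_L2, Fintype.sum_prod_type]
  refine Finset.sum_congr rfl fun i _ => ?_
  rw [EuclideanSpace.real_norm_sq_eq]
  rfl

theorem disagreement_eq (k : ℕ) (i : Fin n) :
    disagreement W Q φ k (estimate W Q μ ν θ φ noise init k) i =
      -(scaleOp (diffusion W φ k Q) (W.laplaceOp (blockError W Q μ ν θ φ noise init k))) i := by
  rw [disagreement, scaleOp_apply, W.laplaceOp_apply_eq_sum, ← smul_neg]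
  congr 1
  have h := W.sum_neighbors i (fun l => estimate W Q μ ν θ φ noise init k i -
    estimate W Q μ ν θ φ noise init k l)
  simp_rw [W.weight_comm _ i]
  rw [h, ← Finset.sum_neg_distrib]
  refine Finset.sum_congr rfl fun l _ => ?_
  rw [← smul_neg]
  congr 1
  simp only [blockError]
  abel

/-- Differences of estimates are minus differences of errors, so the consensus correction becomes `L
X L` acting on the error. -/
theorem blockError_succ (k : ℕ) :
    blockError W Q μ ν θ φ noise init (k + 1) = blockError W Q μ ν θ φ noise init k -
      gradientOp W μ ν (diffusion W φ k Q) (φ k) (r φ k) (blockError W Q μ ν θ φ noise init k) -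
      noiseInput μ φ noise k := by
  apply (WithLp.equiv 2 _).injective
  funext i
  have hsum : ∑ j ∈ W.neighbors i, W.weight i j •
      (disagreement W Q φ k (estimate W Q μ ν θ φ noise init k) i -
        disagreement W Q φ k (estimate W Q μ ν θ φ noise init k) j) =
      -(W.laplaceOp (scaleOp (diffusion W φ k Q)
        (W.laplaceOp (blockError W Q μ ν θ φ noise init k))) i) := by
    rw [W.sum_neighbors i (fun j => disagreement W Q φ k (estimate W Q μ ν θ φ noise init k) i -
        disagreement W Q φ k (estimate W Q μ ν θ φ noise init k) j), W.laplaceOp_apply_eq_sum,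
      ← Finset.sum_neg_distrib]
    refine Finset.sum_congr rfl fun j _ => ?_
    rw [disagreement_eq, disagreement_eq, ← smul_neg]
    congr 1
    abel
  change θ - estimate W Q μ ν θ φ noise init (k + 1) i =
    (θ - estimate W Q μ ν θ φ noise init k i) -
      μ • ((⟪φ k i, θ - estimate W Q μ ν θ φ noise init k i⟫ / r φ k i) • φ k i +
        ν • W.laplaceOp (scaleOp (diffusion W φ k Q)
          (W.laplaceOp (blockError W Q μ ν θ φ noise init k))) i) -
      (μ * noise (k + 1) i / r φ k i) • φ k i
  rw [estimate]
  simp only []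
  rw [hsum, observation, inner_sub_right, real_inner_comm θ (φ k i)]
  module

end Dynamics

end DistributedSG

/-! ### Pathwise convergence and summability of the noise variance. -/

namespace DistributedSG

open scoped ENNReal Topology

variable {m n : ℕ}

section Pathwise

variable {φ : ℕ → Fin n → EuclideanSpace ℝ (Fin m)}

theorem norm_sq_div_r_le_one (k : ℕ) (i : Fin n) : ‖φ (k + 1) i‖ ^ 2 / r φ (k + 1) i ≤ 1 := by
  rw [div_le_one (r_pos φ _ i), r_succ]
  exact le_add_of_nonneg_left (r_pos φ k i).le

theorem norm_sq_le_totalEnergy_sub (k : ℕ) (i : Fin n) :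
    ‖φ (k + 1) i‖ ^ 2 ≤ totalEnergy φ (k + 1) - totalEnergy φ k := by
  rw [totalEnergy_succ, add_sub_cancel_left]
  exact Finset.single_le_sum (f := fun i => ‖φ (k + 1) i‖ ^ 2) (fun i _ => sq_nonneg _)
    (Finset.mem_univ i)

/-- Comparability of each `rⁱ` with the total energy turns a local normalised step into a relative
increment of `s`. -/
theorem norm_sq_div_r_le [Nonempty (Fin n)] {κ : ℝ}
    (hκ : ∀ k i, totalEnergy φ k ≤ κ * r φ k i) (k : ℕ) (i : Fin n) :
    ‖φ (k + 1) i‖ ^ 2 / r φ (k + 1) i ≤ κ * (1 - totalEnergy φ k / totalEnergy φ (k + 1)) := by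
  have hs : 0 < totalEnergy φ (k + 1) := zero_lt_one.trans_le (one_le_totalEnergy φ _)
  have hr := r_pos φ (k + 1) i
  have h1 := norm_sq_le_totalEnergy_sub (φ := φ) k i
  rw [div_le_iff₀ hr]
  have h2 : 1 - totalEnergy φ k / totalEnergy φ (k + 1) =
      (totalEnergy φ (k + 1) - totalEnergy φ k) / totalEnergy φ (k + 1) := by
    rw [sub_div, div_self hs.ne']
  rw [h2]
  have h3 : 0 ≤ totalEnergy φ (k + 1) - totalEnergy φ k := (sq_nonneg _).trans h1
  calc ‖φ (k + 1) i‖ ^ 2 ≤ totalEnergy φ (k + 1) - totalEnergy φ k := h1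
    _ = (totalEnergy φ (k + 1) - totalEnergy φ k) / totalEnergy φ (k + 1) *
        totalEnergy φ (k + 1) := by field_simp
    _ ≤ (totalEnergy φ (k + 1) - totalEnergy φ k) / totalEnergy φ (k + 1) *
        (κ * r φ (k + 1) i) := mul_le_mul_of_nonneg_left (hκ _ i) (by positivity)
    _ = _ := by ring

/-- Pathwise convergence: if the weighted noise sums stay bounded, the estimation error decays
faster than every power of the logarithm of the total energy. -/
theorem exists_norm_blockError_mul_log_pow_le [Nonempty (Fin n)] (hm : 1 ≤ m) (W : SensorGraph n)
    {Q : ℕ} {μ ν : ℝ} (hμ : 0 < μ) (hν : 0 < ν) (hμν : μ * (1 + 4 * ν) ≤ 1)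
    (hconn : W.graph.Connected) (hQ : W.graph.diam ≤ Q) (θ : EuclideanSpace ℝ (Fin m))
    (noise : ℕ → Fin n → ℝ) (init : Fin n → EuclideanSpace ℝ (Fin m))
    {κ : ℝ} (hκ0 : 0 ≤ κ) (hκ : ∀ k i, totalEnergy φ k ≤ κ * r φ k i)
    {M : ℝ} (hM : ∀ k, totalEnergy φ (k + 1) ≤ M * totalEnergy φ k)
    (htop : Tendsto (totalEnergy φ) atTop atTop)
    {N : ℝ} (hN : 0 < N) {K₀ : ℕ} (hexc : ∀ k, K₀ ≤ k →
      lambdaMax (excitation φ k) / lambdaMin (excitation φ k) ≤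
        N * (Real.log ‖R φ k‖) ^ (1 / 3 : ℝ))
    {η : ℝ} (hη : 0 < η) {B : ℝ} (hB : ∀ k, ‖∑ j ∈ Finset.range k,
      totalEnergy φ j ^ η • noiseInput μ φ noise (j + 1)‖ ≤ B) (K : ℕ) :
    ∃ C : ℝ, ∀ k, ‖blockError W Q μ ν θ φ noise init (k + 1)‖ *
      (1 + Real.log (totalEnergy φ k)) ^ K ≤ C := by
  have : Nontrivial (EuclideanSpace ℝ (Fin m)) := by
    have : Nonempty (Fin m) := ⟨⟨0, hm⟩⟩
    infer_instance
  have hmN : 0 < m * N := by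
    have : (0 : ℝ) < m := by exact_mod_cast hm
    positivity
  obtain ⟨c, hc, hge⟩ := exists_sum_inner_gradientOp_ge (E := EuclideanSpace ℝ (Fin m)) W hconn
    hμ hν (W.minPowerEntry_pos hconn hQ)
  refine exists_norm_mul_log_pow_le_of_noise (s := totalEnergy φ) (one_le_totalEnergy φ 0)
    (totalEnergy_mono φ) htop hM
    -- Everything is shifted by one: `r` at time `0` omits `φ 0`, so `‖φ‖² / r ≤ 1` is guaranteed
    -- only from time `1`.
    (A := fun k => gradientOp W μ ν (diffusion W φ (k + 1) Q) (φ (k + 1)) (r φ (k + 1)))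
    hκ0 (fun j v => ?_) (fun j v => ?_) hc hmN (k₀ := K₀) (fun a b hb hab v => ?_)
    (Θ := fun k => blockError W Q μ ν θ φ noise init (k + 1))
    (fun k => blockError_succ W Q μ ν θ φ noise init (k + 1)) hη
    (G := fun k => ∑ j ∈ Finset.range k, totalEnergy φ j ^ η • noiseInput μ φ noise (j + 1))
    (fun k => Finset.sum_range_succ _ _) hB K
  · have := norm_gradientOp_sq_le W hμ.le hν.le hμν (fun i => r_pos φ (j + 1) i)
      (fun i => norm_sq_div_r_le_one j i) (diffusion_nonneg W φ (j + 1) Q)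
      (diffusion_le W φ (fun i => norm_sq_div_r_le_one j i) Q) v
    rwa [one_mul] at this
  · exact norm_gradientOp_sq_le W hμ.le hν.le hμν (fun i => r_pos φ (j + 1) i)
      (fun i => norm_sq_div_r_le hκ j i) (diffusion_nonneg W φ (j + 1) Q)
      (diffusion_le W φ (fun i => norm_sq_div_r_le hκ j i) Q) v
  · exact hge (fun j => diffusion W φ (j + 1) Q) (fun j => r φ (j + 1)) (fun j => φ (j + 1))
      (Finset.Ico a b) _ (fun j i => r_pos φ _ i)
      (fun j i => minPowerEntry_mul_sum_le_diffusion W φ (j + 1) Q i)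
      (fun u => block_excitation_ge hm hN hab (hexc b hb) u) v

theorem norm_R_zero [Nonempty (Fin n)] : ‖R φ 0‖ = 1 :=
  le_antisymm (norm_R_le_of_forall_le φ zero_le_one fun i => by simp [r])
    ((one_le_r φ 0 (Classical.arbitrary _)).trans (r_le_norm_R φ 0 _))

/-- Decay faster than every power of `1 + log s` gives the rate `(log ‖R_k‖) ^ (-p)`. -/
theorem exists_le_mul_log_norm_R_rpow [Nonempty (Fin n)] {e : ℕ → ℝ} {M : ℝ}
    (hM : ∀ k, totalEnergy φ (k + 1) ≤ M * totalEnergy φ k) {p : ℝ} (hp : 0 < p)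
    (h : ∀ K : ℕ, ∃ C : ℝ, ∀ k, e (k + 1) * (1 + Real.log (totalEnergy φ k)) ^ K ≤ C) :
    ∃ C : ℝ, 0 < C ∧ ∀ k, 1 < ‖R φ k‖ → e k ≤ C * (Real.log ‖R φ k‖) ^ (-p) := by
  obtain ⟨C, hC⟩ := h ⌈p⌉₊
  have hs1 := one_le_totalEnergy φ
  have hspos : ∀ k, 0 < totalEnergy φ k := fun k => zero_lt_one.trans_le (hs1 k)
  have hM1 : 1 ≤ M := by
    have h1 := (totalEnergy_mono φ (Nat.zero_le 1)).trans (hM 0)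
    by_contra! hlt
    nlinarith [hspos 0]
  set c := 1 + Real.log M with hc
  have hc1 : 1 ≤ c := by linarith [Real.log_nonneg hM1]
  have hc0 : 0 < c := by linarith
  have hcp : 0 < c ^ p := Real.rpow_pos_of_pos hc0 p
  refine ⟨(|C| + 1) * c ^ p, by positivity, fun k hk => ?_⟩
  cases k with
  -- `‖R 0‖ = 1` excludes `k = 0`, which the shifted bound does not reach.
  | zero => rw [norm_R_zero] at hk; exact absurd hk (lt_irrefl 1)
  | succ k =>
    set y := Real.log ‖R φ (k + 1)‖ with hy
    set l := 1 + Real.log (totalEnergy φ k) with hl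
    have hy0 : 0 < y := Real.log_pos hk
    have hl1 : 1 ≤ l := by linarith [Real.log_nonneg (hs1 k)]
    have hl0 : 0 < l := by linarith
    have hyl : y ≤ c * l := by
      have h1 : y ≤ Real.log M + Real.log (totalEnergy φ k) := by
        rw [← Real.log_mul (by linarith) (hspos k).ne']
        exact Real.log_le_log (by linarith) ((norm_R_le_totalEnergy φ _).trans (hM k))
      nlinarith [Real.log_nonneg hM1, Real.log_nonneg (hs1 k)]
    have hpow : y ^ p ≤ c ^ p * l ^ ⌈p⌉₊ := by
      calc y ^ p ≤ (c * l) ^ p := Real.rpow_le_rpow hy0.le hyl hp.le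
        _ = c ^ p * l ^ p := Real.mul_rpow hc0.le hl0.le
        _ ≤ c ^ p * l ^ (⌈p⌉₊ : ℝ) := by
          gcongr
          exact Nat.le_ceil p
        _ = _ := by rw [Real.rpow_natCast]
    have hyp : 0 < y ^ p := Real.rpow_pos_of_pos hy0 p
    rw [Real.rpow_neg hy0.le, ← div_eq_mul_inv, le_div_iff₀ hyp]
    rcases le_or_gt (e (k + 1)) 0 with he | he
    · exact (mul_nonpos_of_nonpos_of_nonneg he hyp.le).trans (by positivity)
    · calc e (k + 1) * y ^ p ≤ e (k + 1) * (c ^ p * l ^ ⌈p⌉₊) := by gcongr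
        _ = e (k + 1) * l ^ ⌈p⌉₊ * c ^ p := by ring
        _ ≤ (|C| + 1) * c ^ p := by
          gcongr
          exact (hC k).trans (by linarith [le_abs_self C])

/-- The conditional variance of the weighted noise is summable along the path. -/
theorem tsum_variance_ne_top [Nonempty (Fin n)] {κ : ℝ}
    (hκ : ∀ k i, totalEnergy φ k ≤ κ * r φ k i) {c₀ ε η : ℝ} (hc₀ : 0 ≤ c₀) (hε : 0 ≤ ε)
    (hη : 0 < η) (hηε : 2 * η < 1 - ε) (i : Fin n) {g : ℕ → ℝ} {μ : ℝ}
    (hg : ∀ k, |g k| ≤ μ * (totalEnergy φ (k - 1) ^ η * ‖φ k i‖ / r φ k i))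
    {V : ℕ → ℝ≥0∞} (hV : ∀ k, V k ≤ ENNReal.ofReal (c₀ * ‖R φ k‖ ^ ε)) :
    ∑' k, ENNReal.ofReal (g k ^ 2) * V k ≠ ∞ := by
  have hs1 := one_le_totalEnergy φ
  have hspos : ∀ k, 0 < totalEnergy φ k := fun k => zero_lt_one.trans_le (hs1 k)
  set s := totalEnergy φ with hs
  -- The weight contributes `s ^ (2η)`, the noise bound `s ^ ε`, and one normaliser `s⁻¹`; together
  -- `s ^ (-β)`, multiplied by a relative increment of `s`.
  set β : ℝ := 1 - ε - 2 * η with hβ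
  have hβ0 : 0 < β := by linarith
  set D : ℝ := μ ^ 2 * κ ^ 2 * c₀ * β⁻¹ with hD
  have hD0 : 0 ≤ D := by positivity
  have hterm : ∀ k, ENNReal.ofReal (g (k + 1) ^ 2) * V (k + 1) ≤
      ENNReal.ofReal (D * (s k ^ (-β) - s (k + 1) ^ (-β))) := by
    intro k
    refine (mul_le_mul_right (hV (k + 1)) _).trans ?_
    rw [← ENNReal.ofReal_mul (sq_nonneg _)]
    refine ENNReal.ofReal_le_ofReal ?_
    have hr := r_pos φ (k + 1) i
    have hsk := hspos (k + 1)
    have h1 : g (k + 1) ^ 2 ≤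
        μ ^ 2 * (s (k + 1) ^ (2 * η) * ‖φ (k + 1) i‖ ^ 2 / r φ (k + 1) i ^ 2) := by
      have h2 := pow_le_pow_left₀ (abs_nonneg _) (hg (k + 1)) 2
      rw [sq_abs, Nat.add_sub_cancel] at h2
      have h3 : (s k ^ η) ^ 2 ≤ s (k + 1) ^ (2 * η) := by
        rw [← Real.rpow_natCast, ← Real.rpow_mul (hspos k).le, mul_comm η]
        exact Real.rpow_le_rpow (hspos k).le (totalEnergy_mono φ k.le_succ) (by positivity)
      calc g (k + 1) ^ 2 ≤ (μ * (s k ^ η * ‖φ (k + 1) i‖ / r φ (k + 1) i)) ^ 2 := h2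
        _ = μ ^ 2 * ((s k ^ η) ^ 2 * ‖φ (k + 1) i‖ ^ 2 / r φ (k + 1) i ^ 2) := by
          rw [mul_pow, div_pow, mul_pow]
        _ ≤ _ := by gcongr
    have h4 : ‖φ (k + 1) i‖ ^ 2 / r φ (k + 1) i ^ 2 ≤
        κ ^ 2 * ((1 - s k / s (k + 1)) / s (k + 1)) := by
      have h5 : 1 / r φ (k + 1) i ≤ κ / s (k + 1) := by
        rw [div_le_div_iff₀ hr hsk]
        linarith [hκ (k + 1) i]
      have h6 := norm_sq_div_r_le hκ k i
      have h7 : 0 ≤ ‖φ (k + 1) i‖ ^ 2 / r φ (k + 1) i := by positivity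
      calc ‖φ (k + 1) i‖ ^ 2 / r φ (k + 1) i ^ 2 =
            ‖φ (k + 1) i‖ ^ 2 / r φ (k + 1) i * (1 / r φ (k + 1) i) := by field_simp
        _ ≤ κ * (1 - s k / s (k + 1)) * (κ / s (k + 1)) :=
          mul_le_mul h6 h5 (by positivity) (h7.trans h6)
        _ = _ := by ring
    have h8 : ‖R φ (k + 1)‖ ^ ε ≤ s (k + 1) ^ ε :=
      Real.rpow_le_rpow (norm_nonneg _) (norm_R_le_totalEnergy φ _) hε
    have h9 : s (k + 1) ^ (2 * η) * s (k + 1) ^ ε / s (k + 1) = s (k + 1) ^ (-β) := by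
      rw [← Real.rpow_add hsk, div_eq_mul_inv, ← Real.rpow_neg_one (s (k + 1)),
        ← Real.rpow_add hsk]
      congr 1
      rw [hβ]; ring
    calc g (k + 1) ^ 2 * (c₀ * ‖R φ (k + 1)‖ ^ ε)
        ≤ μ ^ 2 * (s (k + 1) ^ (2 * η) * ‖φ (k + 1) i‖ ^ 2 / r φ (k + 1) i ^ 2) *
          (c₀ * s (k + 1) ^ ε) := by gcongr
      _ = μ ^ 2 * c₀ * (s (k + 1) ^ (2 * η) * s (k + 1) ^ ε) *
          (‖φ (k + 1) i‖ ^ 2 / r φ (k + 1) i ^ 2) := by ring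
      _ ≤ μ ^ 2 * c₀ * (s (k + 1) ^ (2 * η) * s (k + 1) ^ ε) *
          (κ ^ 2 * ((1 - s k / s (k + 1)) / s (k + 1))) := by gcongr
      _ = μ ^ 2 * κ ^ 2 * c₀ * ((1 - s k / s (k + 1)) *
          (s (k + 1) ^ (2 * η) * s (k + 1) ^ ε / s (k + 1))) := by ring
      _ ≤ μ ^ 2 * κ ^ 2 * c₀ * (β⁻¹ * (s k ^ (-β) - s (k + 1) ^ (-β))) := by
        rw [h9]
        exact mul_le_mul_of_nonneg_left (one_sub_div_mul_rpow_neg_le (hspos k) hsk hβ0)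
          (by positivity)
      _ = _ := by rw [hD]; ring
  -- The term at time `0`, where `φ 0` is not controlled by `r`, only has to be finite.
  rw [tsum_eq_zero_add' ENNReal.summable]
  refine ENNReal.add_ne_top.2 ⟨ENNReal.mul_ne_top ENNReal.ofReal_ne_top
    (ne_top_of_le_ne_top ENNReal.ofReal_ne_top (hV 0)), ?_⟩
  refine ne_top_of_le_ne_top (ENNReal.ofReal_ne_top (r := D * s 0 ^ (-β))) ?_
  refine ENNReal.tsum_le_of_sum_range_le fun k => ?_
  refine (Finset.sum_le_sum fun j _ => hterm j).trans ?_
  rw [← ENNReal.ofReal_sum_of_nonneg, ← Finset.mul_sum, Finset.sum_range_sub']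
  · refine ENNReal.ofReal_le_ofReal (mul_le_mul_of_nonneg_left ?_ hD0)
    linarith [Real.rpow_nonneg (hspos k).le (-β)]
  · intro j _
    refine mul_nonneg hD0 (sub_nonneg.2 ?_)
    exact Real.rpow_le_rpow_of_nonpos (hspos j) (totalEnergy_mono φ j.le_succ) (by linarith)

end Pathwise

end DistributedSG

/-! ### Measurability, almost sure noise bounds, and positivity of the rate. -/

namespace DistributedSG

open scoped ENNReal Topology

variable {Ω : Type*} {m n : ℕ}

section Measurability

variable {φ : ℕ → Fin n → Ω → EuclideanSpace ℝ (Fin m)} {noise : ℕ → Fin n → Ω → ℝ}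

theorem history_mono : Monotone (history φ noise) := fun _ _ h =>
  sup_le_sup (biSup_mono fun _ hj => le_trans hj h)
    (biSup_mono fun _ hj => ⟨hj.1, hj.2.trans h⟩)

/-- The filtration generated by the regressors and the noise. -/
def historyFiltration [m0 : MeasurableSpace Ω] (hφ : ∀ k i, Measurable (φ k i))
    (hnoise : ∀ k i, 1 ≤ k → Measurable (noise k i)) : Filtration ℕ m0 where
  seq := history φ noise
  mono' := history_mono
  le' _ := sup_le (iSup₂_le fun j _ => iSup_le fun i => (hφ j i).comap_le)
    (iSup₂_le fun j hj => iSup_le fun i => (hnoise j i hj.1).comap_le)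

theorem measurable_regressor {j k : ℕ} (hjk : j ≤ k) (i : Fin n) :
    Measurable[history φ noise k] (φ j i) := by
  rw [measurable_iff_comap_le]
  refine le_trans ?_ le_sup_left
  exact (le_iSup (fun i => MeasurableSpace.comap (φ j i) inferInstance) i).trans
    (le_iSup₂_of_le j hjk le_rfl)

theorem measurable_noise {j k : ℕ} (hj : 1 ≤ j) (hjk : j ≤ k) (i : Fin n) :
    Measurable[history φ noise k] (noise j i) := by
  rw [measurable_iff_comap_le]
  refine le_trans ?_ le_sup_right
  exact (le_iSup (fun i => MeasurableSpace.comap (noise j i) inferInstance) i).trans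
    (le_iSup₂_of_le j ⟨hj, hjk⟩ le_rfl)

theorem measurable_r {j k : ℕ} (hjk : j ≤ k) (i : Fin n) :
    Measurable[history φ noise k] fun ω => r (fun k i => φ k i ω) j i := by
  refine Measurable.const_add (Finset.measurable_fun_sum _ fun l hl => ?_) 1
  exact (measurable_norm.comp (measurable_regressor (noise := noise)
    ((Finset.mem_Icc.1 hl).2.trans hjk) i)).pow_const 2

theorem measurable_totalEnergy {j k : ℕ} (hjk : j ≤ k) :
    Measurable[history φ noise k] fun ω => totalEnergy (fun k i => φ k i ω) j :=
  Finset.measurable_fun_sum _ fun i _ => measurable_r hjk i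

theorem measurable_regressor_coord {j k : ℕ} (hjk : j ≤ k) (i : Fin n) (c : Fin m) :
    Measurable[history φ noise k] fun ω => φ j i ω c :=
  (EuclideanSpace.proj (𝕜 := ℝ) c).continuous.measurable.comp (measurable_regressor hjk i)

end Measurability

/-- The predictable weight of the noise `ε^i_{k+1}` in the `c`-th coordinate of sensor `i`. -/
noncomputable def noiseWeight (μ η : ℝ) (φ : ℕ → Fin n → EuclideanSpace ℝ (Fin m)) (i : Fin n)
    (c : Fin m) (k : ℕ) : ℝ :=
  μ * (totalEnergy φ (k - 1) ^ η * φ k i c / r φ k i)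

theorem abs_noiseWeight_le {μ : ℝ} (hμ : 0 ≤ μ) (η : ℝ)
    (φ : ℕ → Fin n → EuclideanSpace ℝ (Fin m)) (i : Fin n) (c : Fin m) (k : ℕ) :
    |noiseWeight μ η φ i c k| ≤ μ * (totalEnergy φ (k - 1) ^ η * ‖φ k i‖ / r φ k i) := by
  have hs : 0 ≤ totalEnergy φ (k - 1) ^ η :=
    Real.rpow_nonneg (Finset.sum_nonneg fun i _ => (r_pos φ _ i).le) _
  have hr := r_pos φ k i
  rw [noiseWeight, abs_mul, abs_of_nonneg hμ, abs_div, abs_of_pos hr, abs_mul, abs_of_nonneg hs]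
  have h : |φ k i c| ≤ ‖φ k i‖ := PiLp.norm_apply_le (φ k i) c
  gcongr

/-- Bounded coordinates of the weighted noise sums give a bounded weighted noise sum. -/
theorem exists_norm_sum_noiseInput_le {μ η : ℝ} {φ : ℕ → Fin n → EuclideanSpace ℝ (Fin m)}
    {noise : ℕ → Fin n → ℝ}
    (h : ∀ i c, ∃ x, Tendsto (fun k => ∑ j ∈ Finset.range k,
      noiseWeight μ η φ i c j * noise (j + 1) i) atTop (𝓝 x)) :
    ∃ B : ℝ, ∀ k, ‖∑ j ∈ Finset.range k,
      totalEnergy φ j ^ η • noiseInput μ φ noise (j + 1)‖ ≤ B := by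
  have hbdd : ∀ i c, ∃ B : ℝ, ∀ k, |∑ j ∈ Finset.range k,
      noiseWeight μ η φ i c (j + 1) * noise (j + 2) i| ≤ B := by
    intro i c
    obtain ⟨x, hx⟩ := h i c
    obtain ⟨B, hB⟩ := hx.abs.bddAbove_range
    refine ⟨B + |noiseWeight μ η φ i c 0 * noise 1 i|, fun k => ?_⟩
    have h1 : |∑ j ∈ Finset.range (k + 1), noiseWeight μ η φ i c j * noise (j + 1) i| ≤ B :=
      hB ⟨k + 1, rfl⟩
    rw [Finset.sum_range_succ'] at h1
    have h2 := abs_sub (∑ j ∈ Finset.range k, noiseWeight μ η φ i c (j + 1) * noise (j + 2) i +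
      noiseWeight μ η φ i c 0 * noise 1 i) (noiseWeight μ η φ i c 0 * noise 1 i)
    rw [add_sub_cancel_right] at h2
    exact h2.trans (add_le_add h1 le_rfl)
  choose B hB using hbdd
  refine ⟨Real.sqrt (∑ i, ∑ c, B i c ^ 2), fun k => Real.le_sqrt_of_sq_le ?_⟩
  rw [PiLp.norm_sq_eq_of_L2]
  refine Finset.sum_le_sum fun i _ => ?_
  rw [EuclideanSpace.real_norm_sq_eq]
  refine Finset.sum_le_sum fun c _ => ?_
  have h1 : (∑ j ∈ Finset.range k, totalEnergy φ j ^ η • noiseInput μ φ noise (j + 1)) i c =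
      ∑ j ∈ Finset.range k, noiseWeight μ η φ i c (j + 1) * noise (j + 2) i := by
    rw [WithLp.ofLp_sum, Finset.sum_apply, WithLp.ofLp_sum, Finset.sum_apply]
    refine Finset.sum_congr rfl fun j _ => ?_
    simp only [noiseInput, noiseWeight, PiLp.smul_apply, smul_eq_mul, Nat.add_sub_cancel]
    ring
  rw [h1, ← sq_abs]
  exact pow_le_pow_left₀ (abs_nonneg _) (hB i c k) 2

theorem rateExponent_pos [Nonempty (Fin n)] (hm : 1 ≤ m) {W : SensorGraph n} {Q : ℕ}
    (hconn : W.graph.Connected) (hQ : W.graph.diam ≤ Q) {μ ν N γ rStar δ : ℝ} (hμ : 0 < μ)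
    (hν : 0 < ν) (hN : 0 < N) (hγ : 0 ≤ γ) (hr : 0 ≤ rStar) (hδ : 0 < δ) :
    0 < rateExponent W m Q μ ν N γ rStar δ := by
  have hσ := W.couplingConstant_pos hconn hQ hν
  have hm0 : (0 : ℝ) < m := by exact_mod_cast hm
  have hn0 : (0 : ℝ) < n := by
    have : 0 < Fintype.card (Fin n) := Fintype.card_pos
    rw [Fintype.card_fin] at this
    exact_mod_cast this
  have hα : 0 < alpha m n N := by rw [alpha]; positivity
  have hc : 0 < cStar W m Q μ ν N γ rStar := by rw [cStar]; positivity
  rw [rateExponent]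
  positivity

/-- A limsup in `EReal` equal to a real number bounds the ratios eventually, and the finitely many
earlier ones are bounded anyway. -/
theorem exists_r_succ_le_mul {φ : ℕ → Fin n → EuclideanSpace ℝ (Fin m)} {i : Fin n} {x : ℝ}
    (h : limsup (fun k : ℕ => ((r φ (k + 1) i / r φ k i : ℝ) : EReal)) atTop = (x : EReal)) :
    ∃ M : ℝ, ∀ k, r φ (k + 1) i ≤ M * r φ k i := by
  have h1 : limsup (fun k : ℕ => ((r φ (k + 1) i / r φ k i : ℝ) : EReal)) atTop <
      ((x + 1 : ℝ) : EReal) := by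
    rw [h]
    exact_mod_cast lt_add_one x
  have h2 := eventually_lt_of_limsup_lt h1
  have h3 : IsBoundedUnder (· ≤ ·) atTop fun k : ℕ => r φ (k + 1) i / r φ k i :=
    ⟨x + 1, eventually_map.2 (h2.mono fun k hk => (EReal.coe_lt_coe_iff.1 hk).le)⟩
  obtain ⟨M, hM⟩ := h3.bddAbove_range
  exact ⟨M, fun k => (div_le_iff₀ (r_pos φ k i)).1 (hM ⟨k, rfl⟩)⟩

theorem one_le_of_limsup_eq {φ : ℕ → Fin n → EuclideanSpace ℝ (Fin m)} {i : Fin n} {x : ℝ}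
    (h : limsup (fun k : ℕ => ((r φ (k + 1) i / r φ k i : ℝ) : EReal)) atTop = (x : EReal)) :
    1 ≤ x := by
  have h1 : ((1 : ℝ) : EReal) ≤ limsup (fun k : ℕ => ((r φ (k + 1) i / r φ k i : ℝ) : EReal))
      atTop := by
    refine le_limsup_of_frequently_le' (Frequently.of_forall fun k => ?_)
    rw [EReal.coe_le_coe_iff, one_le_div (r_pos φ k i)]
    exact r_mono φ i k.le_succ
  rw [h] at h1
  exact_mod_cast h1

/-- Almost sure convergence of the weighted noise sums, for all small weights simultaneously. -/
theorem ae_exists_tendsto_sum_noiseWeight [MeasurableSpace Ω] (P : Measure Ω)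
    [IsProbabilityMeasure P] [Nonempty (Fin n)] {μ : ℝ} (hμ : 0 ≤ μ)
    {φ : ℕ → Fin n → Ω → EuclideanSpace ℝ (Fin m)} (hφ : ∀ k i, Measurable (φ k i))
    {noise : ℕ → Fin n → Ω → ℝ} (hnoise : ∀ k i, 1 ≤ k → Measurable (noise k i))
    {κ : Ω → ℝ}
    (hκ : ∀ᵐ ω ∂P, ∀ k i, totalEnergy (fun k i => φ k i ω) k ≤
      κ ω * r (fun k i => φ k i ω) k i)
    (hint : ∀ k i, 1 ≤ k → Integrable (noise k i) P)
    (hmart : ∀ k i, P[noise (k + 1) i | history φ noise k] =ᵐ[P] 0)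
    {c₀ ε : Ω → ℝ} (hc₀ : ∀ᵐ ω ∂P, 0 < c₀ ω) (hε : ∀ᵐ ω ∂P, ε ω ∈ Set.Ico (0 : ℝ) 1)
    (hvar : ∀ k, ∀ᵐ ω ∂P,
      (P⁻[fun ω => ENNReal.ofReal (∑ i, noise (k + 1) i ω ^ 2) | history φ noise k]) ω ≤
      ENNReal.ofReal (c₀ ω * ‖R (fun k i => φ k i ω) k‖ ^ (ε ω))) :
    ∀ᵐ ω ∂P, ∃ η : ℝ, 0 < η ∧ ∀ i c, ∃ x, Tendsto (fun k => ∑ j ∈ Finset.range k,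
      noiseWeight μ η (fun k i => φ k i ω) i c j * noise (j + 1) i ω) atTop (𝓝 x) := by
  -- The exponents `1 / (q + 1)` are countable, so one null set serves all of them and the choice
  -- may then depend on the random `ε`.
  have hconv : ∀ᵐ ω ∂P, ∀ (q : ℕ) (i : Fin n) (c : Fin m),
      ∑' k, ENNReal.ofReal (noiseWeight μ (1 / ((q : ℝ) + 1)) (fun k i => φ k i ω) i c k ^ 2) *
        (P⁻[fun ω => ENNReal.ofReal (noise (k + 1) i ω ^ 2) | history φ noise k]) ω ≠ ∞ →
      ∃ x, Tendsto (fun k => ∑ j ∈ Finset.range k,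
        noiseWeight μ (1 / ((q : ℝ) + 1)) (fun k i => φ k i ω) i c j * noise (j + 1) i ω)
        atTop (𝓝 x) := by
    refine ae_all_iff.2 fun q => ae_all_iff.2 fun i => ae_all_iff.2 fun c => ?_
    refine ae_exists_tendsto_sum_of_tsum_condLExp_ne_top (historyFiltration hφ hnoise)
      (g := fun k ω => noiseWeight μ (1 / ((q : ℝ) + 1)) (fun k i => φ k i ω) i c k)
      (ξ := fun k => noise (k + 1) i) (fun k => ?_) (fun k => ?_)
      (fun k => hint (k + 1) i (by omega)) (fun k => hmart k i)
    · refine Measurable.const_mul (Measurable.div (Measurable.mul (Measurable.pow_const ?_ _) ?_)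
        ?_) μ
      · exact measurable_totalEnergy (Nat.sub_le k 1)
      · exact measurable_regressor_coord le_rfl i c
      · exact measurable_r le_rfl i
    · exact measurable_noise (by omega) le_rfl i
  have hmono : ∀ᵐ ω ∂P, ∀ k i,
      (P⁻[fun ω => ENNReal.ofReal (noise (k + 1) i ω ^ 2) | history φ noise k]) ω ≤
      (P⁻[fun ω => ENNReal.ofReal (∑ i, noise (k + 1) i ω ^ 2) | history φ noise k]) ω := by
    refine ae_all_iff.2 fun k => ae_all_iff.2 fun i => ?_
    refine condLExp_mono (ae_of_all _ fun ω => ENNReal.ofReal_le_ofReal ?_)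
    exact Finset.single_le_sum (f := fun i => noise (k + 1) i ω ^ 2) (fun i _ => sq_nonneg _)
      (Finset.mem_univ i)
  filter_upwards [hconv, hmono, hκ, hc₀, hε, ae_all_iff.2 hvar] with ω h1 h2 h4 h5 h6 h7
  obtain ⟨q, hq⟩ := exists_nat_one_div_lt (show (0 : ℝ) < (1 - ε ω) / 2 by linarith [h6.2])
  refine ⟨1 / ((q : ℝ) + 1), by positivity, fun i c => h1 q i c ?_⟩
  exact tsum_variance_ne_top h4 h5.le h6.1 (by positivity) (by linarith) i
    (abs_noiseWeight_le hμ _ _ i c) fun k => (h2 k i).trans (h7 k)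

end DistributedSG

/-! ### Assembly on a common full-measure event. -/

theorem mainTheorem4 {Ω : Type*} [MeasurableSpace Ω] (P : Measure Ω) [IsProbabilityMeasure P]
    {m n : ℕ} (hm : 1 ≤ m) (W : SensorGraph n)
    (Q : ℕ) (μ ν : ℝ) (hμ : μ ∈ Set.Ioo (0 : ℝ) 1) (hν : ν ∈ Set.Ioo (0 : ℝ) 1)
    (hμν : μ * (1 + 4 * ν) < 1)
    -- the graph is connected and the number of diffusion steps is at least its diameter
    (hconn : W.graph.Connected) (hQ : W.graph.diam ≤ Q)
    -- true parameter, regressors, noise, initial estimates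
    (θ : EuclideanSpace ℝ (Fin m))
    (φ : ℕ → Fin n → Ω → EuclideanSpace ℝ (Fin m)) (hφ : ∀ k i, Measurable (φ k i))
    (noise : ℕ → Fin n → Ω → ℝ) (hnoise : ∀ k i, 1 ≤ k → Measurable (noise k i))
    (init : Ω → Fin n → EuclideanSpace ℝ (Fin m))
    -- the ratio `r_k / r_{k-1}` of one sensor has a finite upper limit
    (i₁ : Fin n) (rStar : Ω → ℝ)
    (hrStar : ∀ᵐ ω ∂P,
      limsup (fun k : ℕ => ((DistributedSG.r (fun k i => φ k i ω) (k + 1) i₁ /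
        DistributedSG.r (fun k i => φ k i ω) k i₁ : ℝ) : EReal)) atTop = (rStar ω : EReal))
    -- the condition number of `R_k` is bounded
    (γ : Ω → ℝ)
    (hγ : ∀ᵐ ω ∂P, ∀ k, (⨆ i, DistributedSG.r (fun k i => φ k i ω) k i) /
      (⨅ i, DistributedSG.r (fun k i => φ k i ω) k i) ≤ γ ω)
    -- cooperative excitation condition
    (N : ℝ) (hN : 0 < N) (K₀ : ℕ)
    (hexc : ∀ k, K₀ ≤ k → ∀ᵐ ω ∂P,
      DistributedSG.lambdaMax (DistributedSG.excitation (fun k i => φ k i ω) k) /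
        DistributedSG.lambdaMin (DistributedSG.excitation (fun k i => φ k i ω) k) ≤
      N * (Real.log ‖DistributedSG.R (fun k i => φ k i ω) k‖) ^ (1 / 3 : ℝ))
    (hR : ∀ᵐ ω ∂P, Tendsto (fun k => ‖DistributedSG.R (fun k i => φ k i ω) k‖) atTop atTop)
    -- the noise is a martingale difference sequence with a conditional second moment bound
    (hint : ∀ k i, 1 ≤ k → Integrable (noise k i) P)
    (hmart : ∀ k i, P[noise (k + 1) i | DistributedSG.history φ noise k] =ᵐ[P] 0)
    (c₀ ε : Ω → ℝ) (hc₀ : ∀ᵐ ω ∂P, 0 < c₀ ω) (hε : ∀ᵐ ω ∂P, ε ω ∈ Set.Ico (0 : ℝ) 1)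
    (hvar : ∀ k, ∀ᵐ ω ∂P,
      (P⁻[fun ω => ENNReal.ofReal (∑ i, noise (k + 1) i ω ^ 2) |
        DistributedSG.history φ noise k]) ω ≤
      ENNReal.ofReal (c₀ ω * ‖DistributedSG.R (fun k i => φ k i ω) k‖ ^ (ε ω)))
    (δ : Ω → ℝ) (hδ : ∀ᵐ ω ∂P, δ ω ∈ Set.Ioo (0 : ℝ) ((1 - ε ω) / 2)) :
    ∀ᵐ ω ∂P,
      0 < DistributedSG.rateExponent W m Q μ ν N (γ ω) (rStar ω) (δ ω) ∧
      ∃ C : ℝ, 0 < C ∧ ∀ k, 1 < ‖DistributedSG.R (fun k i => φ k i ω) k‖ →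
        ‖DistributedSG.errorVec W Q μ ν θ (fun k i => φ k i ω) (fun k i => noise k i ω)
            (init ω) k‖ ≤
          C * (Real.log ‖DistributedSG.R (fun k i => φ k i ω) k‖) ^
            (-DistributedSG.rateExponent W m Q μ ν N (γ ω) (rStar ω) (δ ω)) := by
  have : Nonempty (Fin n) := ⟨i₁⟩
  have hratio : ∀ᵐ ω ∂P, 1 ≤ γ ω ∧ ∀ k i, DistributedSG.totalEnergy (fun k i => φ k i ω) k ≤
      n * γ ω * DistributedSG.r (fun k i => φ k i ω) k i := by
    filter_upwards [hγ] with ω h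
    exact ⟨DistributedSG.one_le_of_ratio_le (h 0), fun k i =>
      DistributedSG.totalEnergy_le_mul_r (DistributedSG.r_le_mul_r_of_ratio_le (h k)) i⟩
  have hnoiseSum := DistributedSG.ae_exists_tendsto_sum_noiseWeight P hμ.1.le hφ hnoise
    (κ := fun ω => n * γ ω)
    (hratio.mono fun ω h => h.2) hint hmart hc₀ hε hvar
  have hexc' : ∀ᵐ ω ∂P, ∀ k, K₀ ≤ k →
      DistributedSG.lambdaMax (DistributedSG.excitation (fun k i => φ k i ω) k) /
        DistributedSG.lambdaMin (DistributedSG.excitation (fun k i => φ k i ω) k) ≤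
      N * (Real.log ‖DistributedSG.R (fun k i => φ k i ω) k‖) ^ (1 / 3 : ℝ) := by
    refine ae_all_iff.2 fun k => ?_
    by_cases hk : K₀ ≤ k
    · exact (hexc k hk).mono fun ω h _ => h
    · exact ae_of_all _ fun ω h => absurd h hk
  filter_upwards [hratio, hnoiseSum, hexc', hrStar, hR, hδ] with ω h1 h2 h3 h4 h5 h6
  obtain ⟨hγ1, hκ⟩ := h1
  obtain ⟨η, hη, hlim⟩ := h2
  have hκ0 : 0 ≤ n * γ ω := mul_nonneg (Nat.cast_nonneg n) (zero_le_one.trans hγ1)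
  have hpos := DistributedSG.rateExponent_pos hm hconn hQ hμ.1 hν.1 hN (zero_le_one.trans hγ1)
    (zero_le_one.trans (DistributedSG.one_le_of_limsup_eq h4)) h6.1
  obtain ⟨M, hM⟩ := DistributedSG.exists_r_succ_le_mul h4
  have hM0 : 0 ≤ M := by
    by_contra! hlt
    have hr0 := DistributedSG.r_pos (fun k i => φ k i ω) 0 i₁
    have hr1 := DistributedSG.r_pos (fun k i => φ k i ω) 1 i₁
    nlinarith [hM 0]
  -- Bounded growth at the single sensor `i₁` passes to the total energy through the comparability
  -- of all `rⁱ`.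
  have hstep : ∀ k, DistributedSG.totalEnergy (fun k i => φ k i ω) (k + 1) ≤
      n * γ ω * M * DistributedSG.totalEnergy (fun k i => φ k i ω) k := fun k => by
    calc _ ≤ n * γ ω * DistributedSG.r (fun k i => φ k i ω) (k + 1) i₁ := hκ (k + 1) i₁
      _ ≤ n * γ ω * (M * DistributedSG.r (fun k i => φ k i ω) k i₁) :=
        mul_le_mul_of_nonneg_left (hM k) hκ0
      _ ≤ n * γ ω * (M * DistributedSG.totalEnergy (fun k i => φ k i ω) k) := by
        have := DistributedSG.r_le_totalEnergy (fun k i => φ k i ω) k i₁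
        gcongr
      _ = _ := by ring
  obtain ⟨B, hB⟩ := DistributedSG.exists_norm_sum_noiseInput_le
    (noise := fun k i => noise k i ω) hlim
  refine ⟨hpos, DistributedSG.exists_le_mul_log_norm_R_rpow hstep hpos fun K => ?_⟩
  simp_rw [DistributedSG.norm_errorVec]
  exact DistributedSG.exists_norm_blockError_mul_log_pow_le hm W hμ.1 hν.1 hμν.le hconn hQ θ _
    (init ω) hκ0 hκ hstep
    (tendsto_atTop_mono (DistributedSG.norm_R_le_totalEnergy _) h5) hN h3 hη hB K
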